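/- Let $X$ be a complex Banach space, $B(X)$ the algebra of bounded linear operators on $X$, and let $\sigma\subset\mathbb{C}$ be compact and non-empty. *Definitions.* For a piecewise linear curve $\gamma:[0,1]\to\mathbb{C}$ and a line $\ell$ in the plane, an entry point of $\gamma$ on $\ell$ is a $t\in[0,1]$ with $\gamma(t)\in\ell$ such that $t=0$ or for every $\varepsilon>0$ there is $s\in(t-\varepsilon,t)\cap[0,1]$ with $\gamma(s)\notin\ell$. Let $\mathrm{vf}(\gamma)=\rho(\gamma)^{-1}$ be the maximal number of entry points of $\gamma$ on a line. For $f:\sigma\to\mathbb{C}$ let $\mathrm{cvar}(f,\gamma)$ be the supremum of $\sum_i|f(\gamma(t_{i+1}))-f(\gamma(t_i))|$ over finite increasing sequences $(t_i)$ in $[0,1]$ with $\gamma(t_i)\in\sigma$, and put $$\|f\|_{BV(\sigma)}=\sup_{\sigma}|f|+\sup_\gamma \mathrm{cvar}(f,\gamma)\,\rho(\gamma),$$ the second supremum being over all piecewise linear curves $\gamma:[0,1]\to\mathbb{C}$. $BV(\sigma)$ is the algebra of those $f$ for which this is finite, and $AC(\sigma)$ is the closure in $BV(\sigma)$ of the polynomials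 in $z$ and $\overline z$. An operator $T\in B(X)$ is an *$AC(\sigma)$ operator* if there is a bounded unital algebra homomorphism $\psi:AC(\sigma)\to B(X)$ which maps the function $z\mapsto z$ to $T$. An operator $A\in B(X)$ is *well-bounded* if there are a compact interval $[a,b]\subset\mathbb{R}$ and a constant $K$ such that $\|p(A)\|\le K\bigl(|p(b)|+\mathrm{var}_{[a,b]}\,p\bigr)$ for every polynomial $p$ with complex coefficients. **Corollary.** Let $T\in B(X)$ be a compact $AC(\sigma)$ operator, and let $T=A+iB$ where $A,B\in B(X)$ are commuting well-bounded operators. Then $A+B$ is well-bounded. -/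

import Mathlib

open Set
open scoped ENNReal NNReal

/-- A piecewise linear curve in the plane, parametrised by `[0, 1]`: there is a partition
`0 = τ 0 ≤ τ 1 ≤ ... ≤ τ n = 1` such that `γ` is affine on each closed interval
`[τ i, τ (i + 1)]`. Such a curve is continuous on `[0, 1]`. -/
def IsPiecewiseLinear (γ : ℝ → ℂ) : Prop :=
  ∃ (n : ℕ) (τ : ℕ → ℝ), Monotone τ ∧ τ 0 = 0 ∧ τ n = 1 ∧
    ∀ i < n, ∃ p v : ℂ, ∀ t ∈ Icc (τ i) (τ (i + 1)), γ t = p + (t : ℂ) * v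

/-- The set of all (straight real) lines in the plane. -/
def planeLines : Set (Set ℂ) :=
  {ℓ | ∃ a b c : ℝ, (a ≠ 0 ∨ b ≠ 0) ∧ ℓ = {z : ℂ | a * z.re + b * z.im = c}}

/-- The entry points (recorded by their parameters) of the curve `γ` on the set `ℓ`: those
`t ∈ [0, 1]` with `γ t ∈ ℓ` such that `t = 0` or `γ` is outside `ℓ` at parameters
arbitrarily close to `t` from the left. -/
def entryPoints (γ : ℝ → ℂ) (ℓ : Set ℂ) : Set ℝ :=
  {t | t ∈ Icc (0 : ℝ) 1 ∧ γ t ∈ ℓ ∧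
    (t = 0 ∨ ∀ ε > 0, ∃ s ∈ Ioo (t - ε) t, 0 ≤ s ∧ γ s ∉ ℓ)}

/-- The variation factor of a curve: the maximal number of entry points on a line. -/
noncomputable def variationFactor (γ : ℝ → ℂ) : ℕ∞ :=
  ⨆ ℓ ∈ planeLines, (entryPoints γ ℓ).encard

/-- The variation of `f : σ → ℂ` along the curve `γ`: the supremum of
`∑ |f (γ (t (i + 1))) - f (γ (t i))|` over finite increasing sequences of parameters in `[0, 1]`
with `γ (t i) ∈ σ`. -/
noncomputable def curveVariation {σ : Set ℂ} (f : σ → ℂ) (γ : ℝ → ℂ) : ℝ≥0∞ :=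
  eVariationOn (fun t : {t : ℝ // t ∈ Icc (0 : ℝ) 1 ∧ γ t ∈ σ} => f ⟨γ t, t.2.2⟩) univ

/-- The two-dimensional variation `var(f, σ)`: the supremum over piecewise linear curves of
`cvar(f, γ) ρ(γ)`, where `1 / ρ(γ)` is the variation factor of `γ`. -/
noncomputable def planarVariation {σ : Set ℂ} (f : σ → ℂ) : ℝ≥0∞ :=
  ⨆ (γ : ℝ → ℂ) (_ : IsPiecewiseLinear γ), curveVariation f γ / (variationFactor γ : ℝ≥0∞)

/-- The supremum norm of `f : σ → ℂ`, with values in `[0, ∞]`. -/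
noncomputable def supENorm {σ : Set ℂ} (f : σ → ℂ) : ℝ≥0∞ := ⨆ z, ‖f z‖ₑ

/-- The norm `‖f‖_∞ + var(f, σ)` of `BV(σ)`, with values in `[0, ∞]`; `f` belongs to `BV(σ)`
exactly when it is finite. -/
noncomputable def bvENorm {σ : Set ℂ} (f : σ → ℂ) : ℝ≥0∞ := supENorm f + planarVariation f

/-- The algebra of (restrictions to `σ` of) polynomials in `z` and its conjugate, with complex
coefficients. -/
noncomputable def planePolynomials (σ : Set ℂ) : Subalgebra ℂ (σ → ℂ) :=
  Algebra.adjoin ℂ {fun z : σ => (z : ℂ), fun z : σ => (starRingEnd ℂ) (z : ℂ)}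

section Helpers

variable {σ : Set ℂ}

theorem curveVariation_le_of_edist_le {F g h : σ → ℂ} {a b : ℝ≥0∞}
    (H : ∀ x y, edist (F x) (F y) ≤ a * edist (g x) (g y) + b * edist (h x) (h y)) (γ : ℝ → ℂ) :
    curveVariation F γ ≤ a * curveVariation g γ + b * curveVariation h γ := by
  refine iSup_le fun p => ?_
  refine (Finset.sum_le_sum fun i _ => H _ _).trans ?_
  rw [Finset.sum_add_distrib, ← Finset.mul_sum, ← Finset.mul_sum]
  exact add_le_add
    (mul_le_mul_right (eVariationOn.sum_le p.2.2.1 p.2.2.2) _)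
    (mul_le_mul_right (eVariationOn.sum_le p.2.2.1 p.2.2.2) _)

theorem planarVariation_le_of_edist_le {F g h : σ → ℂ} {a b : ℝ≥0∞}
    (H : ∀ x y, edist (F x) (F y) ≤ a * edist (g x) (g y) + b * edist (h x) (h y)) :
    planarVariation F ≤ a * planarVariation g + b * planarVariation h := by
  refine iSup₂_le fun γ hγ => ?_
  refine (ENNReal.div_le_div_right (curveVariation_le_of_edist_le H γ) _).trans ?_
  rw [ENNReal.add_div, mul_div_assoc, mul_div_assoc]
  have le_var : ∀ k : σ → ℂ, curveVariation k γ / (variationFactor γ : ℝ≥0∞) ≤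
      planarVariation k := fun k => le_iSup₂_of_le γ hγ le_rfl
  exact add_le_add (mul_le_mul_right (le_var g) _) (mul_le_mul_right (le_var h) _)

theorem bvENorm_add_le (f g : σ → ℂ) : bvENorm (f + g) ≤ bvENorm f + bvENorm g := by
  have h1 : supENorm (f + g) ≤ supENorm f + supENorm g :=
    iSup_le fun z => (enorm_add_le (f z) (g z)).trans
      (add_le_add (le_iSup (fun z => ‖f z‖ₑ) z) (le_iSup (fun z => ‖g z‖ₑ) z))
  have h2 : planarVariation (f + g) ≤ 1 * planarVariation f + 1 * planarVariation g := by
    refine planarVariation_le_of_edist_le fun x y => ?_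
    simpa using edist_add_add_le (f x) (g x) (f y) (g y)
  rw [one_mul, one_mul] at h2
  calc bvENorm (f + g) ≤ (supENorm f + supENorm g) + (planarVariation f + planarVariation g) :=
        add_le_add h1 h2
    _ = _ := by unfold bvENorm; ring

theorem bvENorm_mul_le (f g : σ → ℂ) : bvENorm (f * g) ≤ bvENorm f * bvENorm g := by
  have h1 : supENorm (f * g) ≤ supENorm f * supENorm g :=
    iSup_le fun z => (enorm_mul (f z) (g z)).le.trans
      (mul_le_mul' (le_iSup (fun z => ‖f z‖ₑ) z) (le_iSup (fun z => ‖g z‖ₑ) z))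
  have h2 : planarVariation (f * g) ≤
      supENorm f * planarVariation g + supENorm g * planarVariation f := by
    refine planarVariation_le_of_edist_le fun x y => ?_
    have e : f x * g x - f y * g y = f x * (g x - g y) + g y * (f x - f y) := by ring
    rw [edist_eq_enorm_sub, edist_eq_enorm_sub, edist_eq_enorm_sub, Pi.mul_apply, Pi.mul_apply, e]
    refine (enorm_add_le _ _).trans ?_
    rw [enorm_mul, enorm_mul]
    exact add_le_add (mul_le_mul_left (le_iSup (fun z => ‖f z‖ₑ) x) _)
      (mul_le_mul_left (le_iSup (fun z => ‖g z‖ₑ) y) _)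
  calc bvENorm (f * g) ≤ supENorm f * supENorm g +
        (supENorm f * planarVariation g + supENorm g * planarVariation f) := add_le_add h1 h2
    _ ≤ supENorm f * supENorm g +
        (supENorm f * planarVariation g + supENorm g * planarVariation f) +
          planarVariation f * planarVariation g := le_self_add
    _ = _ := by unfold bvENorm; ring

theorem bvENorm_const_ne_top (c : ℂ) : bvENorm (fun _ : σ => c) ≠ ∞ := by
  have h2 : planarVariation (fun _ : σ => c) ≤ 0 := by
    have := planarVariation_le_of_edist_le (σ := σ) (F := fun _ => c) (g := 0) (h := 0)
      (a := 0) (b := 0) (fun x y => by simp)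
    simpa using this
  have h1 : supENorm (fun _ : σ => c) ≤ ‖c‖ₑ := iSup_le fun _ => le_rfl
  exact ne_top_of_le_ne_top (by simp) (add_le_add h1 h2)

theorem bvENorm_zero : bvENorm (0 : σ → ℂ) = 0 := by
  have h2 : planarVariation (0 : σ → ℂ) ≤ 0 := by
    have := planarVariation_le_of_edist_le (σ := σ) (F := 0) (g := 0) (h := 0)
      (a := 0) (b := 0) (fun x y => by simp)
    simpa using this
  have h1 : supENorm (0 : σ → ℂ) ≤ 0 := iSup_le fun _ => by simp
  exact le_antisymm ((add_le_add h1 h2).trans (by simp)) zero_le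

end Helpers

/-- The algebra `AC(σ)` of absolutely continuous functions on `σ`: the closure of the
polynomials in `z` and its conjugate in `BV(σ)`. -/
noncomputable def AC (σ : Set ℂ) : Subalgebra ℂ (σ → ℂ) where
  carrier := {f | bvENorm f ≠ ∞ ∧ ∀ ε > 0, ∃ p ∈ planePolynomials σ, bvENorm (f - p) ≤ ε}
  algebraMap_mem' c := ⟨bvENorm_const_ne_top c, fun ε _ =>
    ⟨algebraMap ℂ _ c, Subalgebra.algebraMap_mem _ c, by simp [bvENorm_zero]⟩⟩
  add_mem' := by
    rintro f g ⟨hf, hf'⟩ ⟨hg, hg'⟩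
    refine ⟨ne_top_of_le_ne_top (ENNReal.add_ne_top.2 ⟨hf, hg⟩) (bvENorm_add_le f g),
      fun ε hε => ?_⟩
    obtain ⟨p, hp, hp'⟩ := hf' (ε / 2) (ENNReal.half_pos hε.ne')
    obtain ⟨q, hq, hq'⟩ := hg' (ε / 2) (ENNReal.half_pos hε.ne')
    refine ⟨p + q, add_mem hp hq, ?_⟩
    rw [add_sub_add_comm]
    exact (bvENorm_add_le _ _).trans ((add_le_add hp' hq').trans (ENNReal.add_halves ε).le)
  mul_mem' := by
    rintro f g ⟨hf, hf'⟩ ⟨hg, hg'⟩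
    refine ⟨ne_top_of_le_ne_top (ENNReal.mul_ne_top hf hg) (bvENorm_mul_le f g),
      fun ε hε => ?_⟩
    have key : ∀ (c : ℝ≥0∞), c ≠ ∞ → ∃ δ > 0, δ ≤ 1 ∧ c * δ ≤ ε / 2 := by
      intro c hc
      refine ⟨min 1 (ε / 2 / c), lt_min one_pos
        (ENNReal.div_pos (ENNReal.half_pos hε.ne').ne' hc), min_le_left _ _, ?_⟩
      exact (mul_le_mul_right (min_le_right _ _) _).trans ENNReal.mul_div_le
    obtain ⟨δ, hδ, hδ1, hδ'⟩ := key _ hg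
    obtain ⟨p, hp, hp'⟩ := hf' δ hδ
    have hpt : bvENorm p ≠ ∞ := by
      have e : p = f + (-1 : σ → ℂ) * (f - p) := by ring
      have h3 : bvENorm (-1 : σ → ℂ) ≠ ∞ := bvENorm_const_ne_top (-1)
      rw [e]
      exact ne_top_of_le_ne_top (ENNReal.add_ne_top.2 ⟨hf, ENNReal.mul_ne_top h3
        (ne_top_of_le_ne_top ENNReal.one_ne_top (hp'.trans hδ1))⟩)
        ((bvENorm_add_le _ _).trans (add_le_add le_rfl (bvENorm_mul_le _ _)))
    obtain ⟨η, hη, -, hη'⟩ := key _ hpt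
    obtain ⟨q, hq, hq'⟩ := hg' η hη
    refine ⟨p * q, mul_mem hp hq, ?_⟩
    have e : f * g - p * q = g * (f - p) + p * (g - q) := by ring
    rw [e]
    calc bvENorm (g * (f - p) + p * (g - q))
        ≤ bvENorm g * bvENorm (f - p) + bvENorm p * bvENorm (g - q) :=
          (bvENorm_add_le _ _).trans (add_le_add (bvENorm_mul_le _ _) (bvENorm_mul_le _ _))
      _ ≤ bvENorm g * δ + bvENorm p * η :=
          add_le_add (mul_le_mul_right hp' _) (mul_le_mul_right hq' _)
      _ ≤ ε := (add_le_add hδ' hη').trans (ENNReal.add_halves ε).le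

/-- `T` is an `AC(σ)` operator: it admits an `AC(σ)` functional calculus, that is, there is a
bounded unital algebra homomorphism `ψ : AC(σ) → B(X)` sending the identity function
`z ↦ z` (which has to belong to `AC(σ)`) to `T`. -/
def IsACOperator {X : Type*} [NormedAddCommGroup X] [NormedSpace ℂ X] (σ : Set ℂ)
    (T : X →L[ℂ] X) : Prop :=
  ∃ ψ : AC σ →ₐ[ℂ] (X →L[ℂ] X),
    (∃ K : ℝ≥0, ∀ f : AC σ, ‖ψ f‖ₑ ≤ K * bvENorm (f : σ → ℂ)) ∧
    ∃ h : (fun z : σ => (z : ℂ)) ∈ AC σ, ψ ⟨_, h⟩ = T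

/-- `A` is well-bounded: there are a compact interval `[a, b]` and a constant `K` such that
`‖p(A)‖ ≤ K (|p(b)| + var_{[a, b]} p)` for every polynomial `p`. -/
def IsWellBounded {X : Type*} [NormedAddCommGroup X] [NormedSpace ℂ X] (A : X →L[ℂ] X) : Prop :=
  ∃ (a b : ℝ) (K : ℝ≥0), a ≤ b ∧ ∀ p : Polynomial ℂ,
    ‖Polynomial.aeval A p‖ₑ ≤
      K * (‖p.eval (b : ℂ)‖ₑ + eVariationOn (fun t : ℝ => p.eval (t : ℂ)) (Icc a b))

/-!
An `AC(σ)` functional calculus `ψ` for `T` provides the operators `A' = ψ (Re)` and `B' = ψ (Im)`,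
which commute, satisfy `T = A' + i B'`, and are well-bounded: for a real linear functional `L` of
the plane, the planar variation of `h ∘ L` is at most the one-dimensional variation of `h`
(`planarVariation_ridge_le`), since a curve passes a level `L = u` at most as often as it has entry
points on that line. For the same reason `A' + B' = ψ (Re + Im)` is well-bounded. It remains
to see that a compact `T` has only one such splitting, that is, `A = A'` and `B = B'`.

The main tool is `IsWellBounded.mem_of_add_I_smul_pow_mem`: if `A`, `B` are commuting well-bounded
operators and `A + i B` is nilpotent modulo a closed left ideal `J`, then `A ∈ J`. The group
`exp (i t A)` grows at most linearly in `t`, and so does `exp (i t B)`. Modulo `J`, up to a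
polynomial factor, `exp (t A)` is `exp (-i t B)`, so `exp (z A)` has polynomial growth in the whole
plane and `A` is nilpotent modulo `J` by the Liouville theorem. A nilpotent well-bounded element is
zero, because differentiation at a point is not bounded by the variation norm.

* With `J` the compact operators, `A'` and `B'` are compact.
* With `J` the operators vanishing at a vector `x`, a generalised eigenvector `x` of `T` for `μ`
  satisfies `A x = Re μ x = A' x`, so that `D = A - A'` vanishes at `x`.

A compact `C = ψ L` is a norm limit of operators `f(C)`, where `f` vanishes near the origin; the
range of `f(C)` is contained in a finite-dimensional space invariant under `T`, which is spanned by
generalised eigenvectors of `T`. Hence `D A' = D B' = 0`, and `D T = T D = 0`. The range of `D`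
consists of null vectors of `T`, so `A D = A' D = 0`. It follows that `p(A) = p(A') + p'(0) D` for
every polynomial `p`, and choosing `p` of small variation with `p'(0) = 1` gives `D = 0`.
-/

/-! ### Planar variation of functions of one real coordinate -/

theorem IsPiecewiseLinear.continuousOn {γ : ℝ → ℂ} (hγ : IsPiecewiseLinear γ) :
    ContinuousOn γ (Icc 0 1) := by
  obtain ⟨n, τ, hτ, h0, h1, H⟩ := hγ
  have key : ∀ k ≤ n, ContinuousOn γ (Icc (τ 0) (τ k)) := by
    intro k
    induction k with
    | zero => intro _; simp
    | succ k ih =>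
      intro hk
      obtain ⟨p, v, hpv⟩ := H k (by omega)
      have h2 : ContinuousOn γ (Icc (τ k) (τ (k + 1))) := by
        refine ContinuousOn.congr (f := fun t : ℝ => p + (t : ℂ) * v) ?_ hpv
        fun_prop
      rw [← Icc_union_Icc_eq_Icc (hτ (Nat.zero_le k)) (hτ (Nat.le_succ k))]
      exact (ih (by omega)).union_of_isClosed h2 isClosed_Icc isClosed_Icc
  simpa [h0, h1] using key n le_rfl

/-- If a real functional of the curve has a level strictly between its values at `s` and `t`, then
the curve has an entry point on the corresponding level line strictly between `s` and `t`: the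
first time after `s` at which the level is attained. -/
theorem exists_mem_entryPoints_Ioo {γ : ℝ → ℂ} (hγ : ContinuousOn γ (Icc 0 1)) {L : ℂ → ℝ}
    (hL : Continuous L) {s t u : ℝ} (hs : 0 ≤ s) (hst : s ≤ t) (ht : t ≤ 1)
    (hu : u ∈ Ioo (min (L (γ s)) (L (γ t))) (max (L (γ s)) (L (γ t)))) :
    ∃ r ∈ Ioo s t, r ∈ entryPoints γ {z | L z = u} := by
  have hc : ContinuousOn (fun r => L (γ r)) (Icc s t) :=
    hL.comp_continuousOn (hγ.mono (Icc_subset_Icc hs ht))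
  have hsu : L (γ s) ≠ u := by
    rintro rfl
    rcases le_total (L (γ s)) (L (γ t)) with h | h <;> simp [h] at hu
  have htu : L (γ t) ≠ u := by
    rintro rfl
    rcases le_total (L (γ s)) (L (γ t)) with h | h <;> simp [h] at hu
  set Z : Set ℝ := {r ∈ Icc s t | L (γ r) = u} with hZ
  have hZne : Z.Nonempty := by
    have := intermediate_value_uIcc (f := fun r => L (γ r)) (a := s) (b := t)
      (by rwa [uIcc_of_le hst])
    obtain ⟨r, hr, hr'⟩ := this (show u ∈ uIcc _ _ from ⟨hu.1.le, hu.2.le⟩)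
    exact ⟨r, by rwa [uIcc_of_le hst] at hr, hr'⟩
  have hZc : IsClosed Z :=
    hc.preimage_isClosed_of_isClosed isClosed_Icc (isClosed_singleton (x := u))
  have hZb : BddBelow Z := ⟨s, fun r hr => hr.1.1⟩
  have hm : sInf Z ∈ Z := hZc.csInf_mem hZne hZb
  set r := sInf Z
  have hsr : s < r := lt_of_le_of_ne hm.1.1 (by rintro h; exact hsu (h ▸ hm.2))
  have hrt : r < t := lt_of_le_of_ne hm.1.2 (by rintro h; exact htu (h ▸ hm.2))
  refine ⟨r, ⟨hsr, hrt⟩, ⟨hs.trans hsr.le, hrt.le.trans ht⟩, hm.2, Or.inr fun ε hε => ?_⟩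
  have hlt : max s (r - ε) < r := max_lt hsr (by linarith)
  obtain ⟨q, hq1, hq2⟩ := exists_between hlt
  refine ⟨q, ⟨(le_max_right _ _).trans_lt hq1, hq2⟩,
    hs.trans ((le_max_left _ _).trans hq1.le), fun hq => ?_⟩
  exact absurd (csInf_le hZb (⟨⟨(le_max_left _ _).trans hq1.le, (hq2.trans hrt).le⟩, hq⟩ : q ∈ Z))
    (not_le.2 hq2)

/-- Along a monotone sequence of parameters, the number of steps at which a real functional of the
curve passes strictly through a given level is at most the number of entry points on the
corresponding level line. -/
theorem card_crossing_le {γ : ℝ → ℂ} (hγ : ContinuousOn γ (Icc 0 1)) {L : ℂ → ℝ}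
    (hL : Continuous L) {t : ℕ → ℝ} (ht : Monotone t) (ht' : ∀ i, t i ∈ Icc (0 : ℝ) 1)
    (u : ℝ) (S : Finset ℕ) (hS : ∀ i ∈ S,
      u ∈ Ioo (min (L (γ (t i))) (L (γ (t (i + 1))))) (max (L (γ (t i))) (L (γ (t (i + 1)))))) :
    (S.card : ℕ∞) ≤ (entryPoints γ {z | L z = u}).encard := by
  have H : ∀ i, ∃ r, i ∈ S → r ∈ Ioo (t i) (t (i + 1)) ∧ r ∈ entryPoints γ {z | L z = u} := by
    intro i
    by_cases hi : i ∈ S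
    · obtain ⟨r, hr, hr'⟩ := exists_mem_entryPoints_Ioo hγ hL (ht' i).1 (ht (Nat.le_succ i))
        (ht' (i + 1)).2 (hS i hi)
      exact ⟨r, fun _ => ⟨hr, hr'⟩⟩
    · exact ⟨0, fun h => absurd h hi⟩
  choose r hr using H
  have hinj : InjOn r (S : Set ℕ) := by
    have key : ∀ i ∈ S, ∀ j ∈ S, i < j → r i < r j := fun i hi j hj hij =>
      ((hr i hi).1.2.trans_le (ht hij)).trans (hr j hj).1.1
    intro i hi j hj hij
    rcases lt_trichotomy i j with h | h | h
    · exact absurd hij (key i hi j hj h).ne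
    · exact h
    · exact absurd hij (key j hj i hi h).ne'
  calc (S.card : ℕ∞) = (S : Set ℕ).encard := (encard_coe_eq_coe_finsetCard S).symm
    _ = (r '' (S : Set ℕ)).encard := hinj.encard_image.symm
    _ ≤ _ := encard_le_encard (by rintro _ ⟨i, hi, rfl⟩; exact (hr i hi).2)

/-- A finite sequence of reals can be listed monotonically. -/
theorem exists_monotone_listing (x : ℕ → ℝ) (n : ℕ) :
    ∃ (y : ℕ → ℝ) (k : ℕ → ℕ) (m : ℕ), Monotone y ∧ (∀ j, ∃ i ≤ n, y j = x i) ∧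
      ∀ i ≤ n, k i ≤ m ∧ x i = y (k i) := by
  classical
  set S : Finset ℝ := (Finset.range (n + 1)).image x with hS
  have hpos : 0 < S.card := Finset.card_pos.2 ⟨x 0, Finset.mem_image.2 ⟨0, by simp, rfl⟩⟩
  set e := S.orderEmbOfFin rfl
  let y : ℕ → ℝ := fun j => e ⟨min j (S.card - 1), by omega⟩
  have H : ∀ i, ∃ k, i ≤ n → k ≤ S.card - 1 ∧ x i = y k := by
    intro i
    by_cases hi : i ≤ n
    · have : x i ∈ Set.range e := by
        rw [Finset.range_orderEmbOfFin]
        exact Finset.mem_coe.2 (Finset.mem_image.2 ⟨i, by simpa [Nat.lt_succ_iff] using hi, rfl⟩)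
      obtain ⟨k, hk⟩ := this
      refine ⟨k, fun _ => ⟨by omega, ?_⟩⟩
      rw [← hk]
      congr 1
      ext
      simp
      omega
    · exact ⟨0, fun h => absurd h hi⟩
  choose k hk using H
  refine ⟨y, k, S.card - 1, ?_, ?_, hk⟩
  · intro a b hab
    exact e.monotone (by simp [Fin.le_def]; omega)
  · intro j
    have : y j ∈ S := S.orderEmbOfFin_mem rfl _
    obtain ⟨i, hi, hi'⟩ := Finset.mem_image.1 this
    exact ⟨i, by simpa [Nat.lt_succ_iff] using hi, hi'.symm⟩

/-- The double counting behind the comparison of planar and one-dimensional variation: if every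
level off the finite sequence `x` lies strictly between `x i` and `x (i + 1)` for at most `N`
indices `i < n`, then `∑ |h (x (i + 1)) - h (x i)| ≤ N * var h`. -/
theorem sum_edist_le_mul_eVariationOn {E : Type*} [PseudoEMetricSpace E] (h : ℝ → E) {s : Set ℝ}
    (x : ℕ → ℝ) (n : ℕ) (hx : ∀ i, x i ∈ s) (N : ℝ≥0∞)
    (hN : ∀ (u : ℝ) (S : Finset ℕ), (∀ i ∈ S, u ∈ Ioo (min (x i) (x (i + 1)))
      (max (x i) (x (i + 1)))) → (S.card : ℝ≥0∞) ≤ N) :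
    ∑ i ∈ Finset.range n, edist (h (x (i + 1))) (h (x i)) ≤ N * eVariationOn h s := by
  classical
  obtain ⟨y, k, m, hy, hyx, hk⟩ := exists_monotone_listing x n
  set d : ℕ → ℝ≥0∞ := fun j => edist (h (y j)) (h (y (j + 1))) with hd
  let I : ℕ → Finset ℕ := fun i => Finset.Ico (min (k i) (k (i + 1))) (max (k i) (k (i + 1)))
  have hI : ∀ i < n, I i ⊆ Finset.range m := fun i hi j hj => by
    have h1 := (hk i hi.le).1
    have h2 := (hk (i + 1) hi).1
    simp only [I, Finset.mem_Ico, Finset.mem_range] at hj ⊢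
    omega
  have h1 : ∀ i < n, edist (h (x (i + 1))) (h (x i)) ≤ ∑ j ∈ I i, d j := by
    intro i hi
    rw [(hk i hi.le).2, (hk (i + 1) hi).2]
    rcases le_total (k i) (k (i + 1)) with hle | hle
    · simp only [I, min_eq_left hle, max_eq_right hle]
      rw [edist_comm]
      exact edist_le_Ico_sum_edist (fun j => h (y j)) hle
    · simp only [I, min_eq_right hle, max_eq_left hle]
      exact edist_le_Ico_sum_edist (fun j => h (y j)) hle
  calc ∑ i ∈ Finset.range n, edist (h (x (i + 1))) (h (x i))
      ≤ ∑ i ∈ Finset.range n, ∑ j ∈ Finset.range m, if j ∈ I i then d j else 0 := by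
        refine Finset.sum_le_sum fun i hi => (h1 i (Finset.mem_range.1 hi)).trans (le_of_eq ?_)
        rw [← Finset.sum_filter]
        refine Finset.sum_congr ?_ fun _ _ => rfl
        ext j
        simp only [Finset.mem_filter]
        exact ⟨fun hj => ⟨hI i (Finset.mem_range.1 hi) hj, hj⟩, fun hj => hj.2⟩
    _ = ∑ j ∈ Finset.range m, ∑ i ∈ Finset.range n, if j ∈ I i then d j else 0 :=
        Finset.sum_comm
    _ ≤ ∑ j ∈ Finset.range m, N * d j := by
        refine Finset.sum_le_sum fun j _ => ?_
        rw [← Finset.sum_filter, Finset.sum_const, nsmul_eq_mul]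
        rcases (hy (Nat.le_succ j)).eq_or_lt with he | hlt
        · simp [hd, he]
        · -- all the intervals counted contain the midpoint of the gap `(y j, y (j + 1))`
          refine mul_le_mul_left (hN ((y j + y (j + 1)) / 2) _ fun i hi => ?_) _
          obtain ⟨hi, hj⟩ := Finset.mem_filter.1 hi
          have hi := Finset.mem_range.1 hi
          rw [(hk i hi.le).2, (hk (i + 1) hi).2, ← hy.map_min, ← hy.map_max]
          simp only [I, Finset.mem_Ico] at hj
          have h2 := hy hj.1
          have h3 := hy (Nat.succ_le_of_lt hj.2)
          simp only [Nat.succ_eq_add_one] at h3 hlt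
          constructor <;> linarith
    _ = N * ∑ j ∈ Finset.range m, d j := by rw [Finset.mul_sum]
    _ ≤ N * eVariationOn h s := by
        refine mul_le_mul_right ?_ _
        refine le_trans (le_of_eq ?_) (eVariationOn.sum_le (n := m) hy fun j => ?_)
        · exact Finset.sum_congr rfl fun j _ => edist_comm _ _
        · obtain ⟨i, -, hi⟩ := hyx j
          exact hi ▸ hx i

/-- The real linear functional `z ↦ α Re z + β Im z`. -/
def planeFunctional (α β : ℝ) (z : ℂ) : ℝ := α * z.re + β * z.im

theorem continuous_planeFunctional (α β : ℝ) : Continuous (planeFunctional α β) := by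
  unfold planeFunctional
  fun_prop

/-- A ridge function, that is, a function of a single real linear functional, has planar variation
at most the one-dimensional variation of its profile. -/
theorem planarVariation_ridge_le {σ : Set ℂ} {α β a b : ℝ} (hαβ : α ≠ 0 ∨ β ≠ 0)
    (hσ : ∀ z ∈ σ, planeFunctional α β z ∈ Icc a b) (h : ℝ → ℂ) :
    planarVariation (fun z : σ => h (planeFunctional α β z)) ≤ eVariationOn h (Icc a b) := by
  refine iSup₂_le fun γ hγ => ENNReal.div_le_of_le_mul ?_
  refine iSup_le fun p => ?_
  obtain ⟨n, t, ht, -⟩ := p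
  rw [mul_comm]
  refine sum_edist_le_mul_eVariationOn h (fun i => planeFunctional α β (γ (t i))) n
    (fun i => hσ _ (t i).2.2) _ fun u S hS => ?_
  have h1 := card_crossing_le hγ.continuousOn (continuous_planeFunctional α β)
    (t := fun i => (t i : ℝ)) (fun i j hij => ht hij) (fun i => (t i).2.1) u S hS
  have h2 : (entryPoints γ {z | planeFunctional α β z = u}).encard ≤ variationFactor γ :=
    le_iSup₂_of_le (f := fun ℓ (_ : ℓ ∈ planeLines) => (entryPoints γ ℓ).encard)
      {z | planeFunctional α β z = u} ⟨α, β, u, hαβ, rfl⟩ le_rfl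
  have h3 : ((S.card : ℕ∞) : ℝ≥0∞) ≤ (variationFactor γ : ℝ≥0∞) :=
    ENat.toENNReal_le.2 (h1.trans h2)
  simpa using h3

/-- The `BV` norm of a ridge function is controlled by any value of its profile and the
variation of the profile. -/
theorem bvENorm_ridge_le {σ : Set ℂ} {α β a b c : ℝ} (hαβ : α ≠ 0 ∨ β ≠ 0)
    (hσ : ∀ z ∈ σ, planeFunctional α β z ∈ Icc a b) (hc : c ∈ Icc a b) (h : ℝ → ℂ) :
    bvENorm (fun z : σ => h (planeFunctional α β z)) ≤ ‖h c‖ₑ + 2 * eVariationOn h (Icc a b) := by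
  have h1 : supENorm (fun z : σ => h (planeFunctional α β z)) ≤
      ‖h c‖ₑ + eVariationOn h (Icc a b) := by
    refine iSup_le fun z => ?_
    have := eVariationOn.edist_le h (hσ z z.2) hc
    rw [edist_eq_enorm_sub] at this
    calc ‖h (planeFunctional α β z)‖ₑ = ‖h c + (h (planeFunctional α β z) - h c)‖ₑ := by
          rw [add_sub_cancel]
      _ ≤ _ := (enorm_add_le _ _).trans (add_le_add le_rfl this)
  calc bvENorm (fun z : σ => h (planeFunctional α β z))
      ≤ (‖h c‖ₑ + eVariationOn h (Icc a b)) + eVariationOn h (Icc a b) :=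
        add_le_add h1 (planarVariation_ridge_le hαβ hσ h)
    _ = _ := by rw [two_mul, add_assoc]

/-! ### Variation on the line and polynomial approximation -/

theorem eVariationOn_add_le {E : Type*} [NormedAddCommGroup E] (f g : ℝ → E) (s : Set ℝ) :
    eVariationOn (fun t => f t + g t) s ≤ eVariationOn f s + eVariationOn g s := by
  refine iSup_le fun p => ?_
  refine (Finset.sum_le_sum fun i _ => edist_add_add_le _ _ _ _).trans ?_
  rw [Finset.sum_add_distrib]
  exact add_le_add (eVariationOn.sum_le p.2.2.1 p.2.2.2) (eVariationOn.sum_le p.2.2.1 p.2.2.2)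

theorem eVariationOn_const_mul_le (c : ℂ) (f : ℝ → ℂ) (s : Set ℝ) :
    eVariationOn (fun t => c * f t) s ≤ ‖c‖ₑ * eVariationOn f s := by
  have h : LipschitzOnWith ‖c‖₊ (fun z : ℂ => c * z) univ := fun x _ y _ => by
    simp only [edist_eq_enorm_sub, ← mul_sub, enorm_mul]
    rfl
  exact h.comp_eVariationOn_le (mapsTo_univ f s)

theorem eVariationOn_ofReal_le (f : ℝ → ℝ) (s : Set ℝ) :
    eVariationOn (fun t => (f t : ℂ)) s ≤ eVariationOn f s := by
  have h : LipschitzOnWith 1 (fun x : ℝ => (x : ℂ)) univ :=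
    (Complex.isometry_ofReal.lipschitz).lipschitzOnWith
  exact (h.comp_eVariationOn_le (mapsTo_univ f s)).trans (by simp)

theorem eVariationOn_le_of_norm_deriv_le {E : Type*} [NormedAddCommGroup E] [NormedSpace ℝ E]
    {f f' : ℝ → E} {a b C : ℝ} (hC : 0 ≤ C) (hf : ∀ x ∈ Icc a b, HasDerivAt f (f' x) x)
    (hf' : ∀ x ∈ Icc a b, ‖f' x‖ ≤ C) :
    eVariationOn f (Icc a b) ≤ ENNReal.ofReal (C * (b - a)) := by
  have h : LipschitzOnWith C.toNNReal f (Icc a b) :=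
    (convex_Icc a b).lipschitzOnWith_of_nnnorm_hasDerivWithin_le
      (fun x hx => (hf x hx).hasDerivWithinAt) fun x hx => by
        rw [← NNReal.coe_le_coe, coe_nnnorm, Real.coe_toNNReal _ hC]
        exact hf' x hx
  have := h.comp_eVariationOn_le (g := id) (s := Icc a b) (mapsTo_id _)
  rw [eVariationOn_id_Icc] at this
  rwa [ENNReal.ofReal_mul hC]

theorem eVariationOn_le_of_monotone {f : ℝ → ℝ} (hf : Monotone f) {a b : ℝ} (hab : a ≤ b) :
    eVariationOn f (Icc a b) ≤ ENNReal.ofReal (f b - f a) := by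
  simpa using ((hf.monotoneOn (Icc a b)).eVariationOn_eq (left_mem_Icc.2 hab)
    (right_mem_Icc.2 hab)).le

theorem Polynomial.exists_derivative_eq (q : Polynomial ℝ) :
    ∃ p : Polynomial ℝ, Polynomial.derivative p = q := by
  induction q using Polynomial.induction_on' with
  | add p q hp hq =>
    obtain ⟨p', rfl⟩ := hp
    obtain ⟨q', rfl⟩ := hq
    exact ⟨p' + q', by simp⟩
  | monomial n c =>
    refine ⟨Polynomial.monomial (n + 1) (c / (n + 1)), ?_⟩
    rw [Polynomial.derivative_monomial]
    have : (n : ℝ) + 1 ≠ 0 := by positivity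
    simp [div_mul_cancel₀ _ this]

/-- Polynomial approximation of a `C¹` function in the sense of variation: integrate a uniform
approximation of the derivative. -/
theorem exists_polynomial_near_contDiff {h : ℝ → ℝ} (hh : ContDiff ℝ 1 h) (a b : ℝ) {δ : ℝ}
    (hδ : 0 < δ) : ∃ p : Polynomial ℝ, p.eval b = h b ∧
      (∀ x ∈ Icc a b, |p.derivative.eval x - deriv h x| ≤ δ) ∧
      eVariationOn (fun t => (h t : ℂ) - (p.eval t : ℝ)) (Icc a b) ≤
        ENNReal.ofReal (δ * (b - a)) := by
  obtain ⟨q, hq⟩ := exists_polynomial_near_of_continuousOn a b (deriv h)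
    (hh.continuous_deriv le_rfl).continuousOn δ hδ
  obtain ⟨p, rfl⟩ := q.exists_derivative_eq
  have hq' : ∀ x ∈ Icc a b,
      |(p + Polynomial.C (h b - p.eval b)).derivative.eval x - deriv h x| ≤ δ := fun x hx => by
    simpa using (hq x hx).le
  refine ⟨p + Polynomial.C (h b - p.eval b), by simp, hq', ?_⟩
  set r := p + Polynomial.C (h b - p.eval b)
  have := eVariationOn_ofReal_le (fun t => h t - r.eval t) (Icc a b)
  push_cast at this
  refine this.trans (eVariationOn_le_of_norm_deriv_le hδ.le
    (f' := fun x => deriv h x - r.derivative.eval x) (fun x _ => ?_) fun x hx => ?_)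
  · exact ((hh.differentiable one_ne_zero) x).hasDerivAt.sub (r.hasDerivAt x)
  · rw [Real.norm_eq_abs, abs_sub_comm]
    exact hq' x hx

/-! ### Ridge functions in `AC(σ)` -/

theorem planeFunctional_mem_planePolynomials (σ : Set ℂ) (α β : ℝ) :
    (fun z : σ => (planeFunctional α β z : ℂ)) ∈ planePolynomials σ := by
  set S := planePolynomials σ
  have h1 : (fun z : σ => (z : ℂ)) ∈ S := Algebra.subset_adjoin (by simp)
  have h2 : (fun z : σ => (starRingEnd ℂ) (z : ℂ)) ∈ S := Algebra.subset_adjoin (by simp)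
  have : (fun z : σ => (planeFunctional α β z : ℂ)) =
      ((α : ℂ) / 2 - (β : ℂ) / 2 * Complex.I) • (fun z : σ => (z : ℂ)) +
      ((α : ℂ) / 2 + (β : ℂ) / 2 * Complex.I) • (fun z : σ => (starRingEnd ℂ) (z : ℂ)) := by
    ext z
    apply Complex.ext <;> simp [planeFunctional] <;> ring
  rw [this]
  exact add_mem (S.smul_mem h1 _) (S.smul_mem h2 _)

theorem aeval_planeFunctional (σ : Set ℂ) (α β : ℝ) (p : Polynomial ℂ) :
    Polynomial.aeval (fun z : σ => (planeFunctional α β z : ℂ)) p =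
      fun z : σ => p.eval (planeFunctional α β z : ℂ) := by
  ext z
  simp

/-- A ridge function with a `C¹` profile belongs to `AC(σ)`. -/
theorem ridge_mem_AC {σ : Set ℂ} {α β a b : ℝ} (hαβ : α ≠ 0 ∨ β ≠ 0) (hab : a ≤ b)
    (hσ : ∀ z ∈ σ, planeFunctional α β z ∈ Icc a b) {h : ℝ → ℝ} (hh : ContDiff ℝ 1 h) :
    (fun z : σ => (h (planeFunctional α β z) : ℂ)) ∈ AC σ := by
  refine ⟨?_, fun ε hε => ?_⟩
  · obtain ⟨C, hC⟩ := isCompact_Icc.exists_bound_of_continuousOn (s := Icc a b)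
      (hh.continuous_deriv le_rfl).continuousOn
    refine ne_top_of_le_ne_top ?_ (bvENorm_ridge_le hαβ hσ (right_mem_Icc.2 hab) fun t => (h t : ℂ))
    have h1 : eVariationOn (fun t => (h t : ℂ)) (Icc a b) ≠ ∞ := by
      refine ne_top_of_le_ne_top ENNReal.ofReal_ne_top ((eVariationOn_ofReal_le h _).trans
        (eVariationOn_le_of_norm_deriv_le ((norm_nonneg _).trans (hC b (right_mem_Icc.2 hab)))
          (fun x _ => ((hh.differentiable one_ne_zero) x).hasDerivAt) hC))
    exact ENNReal.add_ne_top.2 ⟨by simp, ENNReal.mul_ne_top (by simp) h1⟩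
  · obtain ⟨η, hη0, hη⟩ : ∃ η : ℝ, 0 < η ∧ ENNReal.ofReal η ≤ ε := by
      obtain ⟨η, hη0, hη⟩ := ENNReal.lt_iff_exists_nnreal_btwn.1 hε
      exact ⟨η, by simpa using hη0, by simpa using hη.le⟩
    obtain ⟨p, hpb, -, hp⟩ := exists_polynomial_near_contDiff hh a b
      (δ := η / (2 * (b - a) + 1)) (by have := sub_nonneg.2 hab; positivity)
    refine ⟨fun z => ((p.eval (planeFunctional α β z) : ℝ) : ℂ), ?_, ?_⟩
    · have h1 := aeval_planeFunctional σ α β (p.map Complex.ofRealHom)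
      have h2 : (fun z : σ => ((p.eval (planeFunctional α β z) : ℝ) : ℂ)) =
          Polynomial.aeval (fun z : σ => (planeFunctional α β z : ℂ))
            (p.map Complex.ofRealHom) := by
        rw [h1]
        ext z
        exact (Polynomial.eval_map_apply (f := Complex.ofRealHom) (p := p)
          (planeFunctional α β z)).symm
      rw [h2]
      exact Algebra.adjoin_le (by simpa using planeFunctional_mem_planePolynomials σ α β)
        (Polynomial.aeval_mem_adjoin_singleton ℂ _)
    · refine (bvENorm_ridge_le hαβ hσ (right_mem_Icc.2 hab)
        fun t => (h t : ℂ) - (p.eval t : ℝ)).trans ?_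
      rw [hpb, sub_self, enorm_zero, zero_add]
      refine ((mul_le_mul_right hp 2).trans ?_).trans hη
      rw [← ENNReal.ofReal_ofNat 2, ← ENNReal.ofReal_mul (by norm_num)]
      refine ENNReal.ofReal_le_ofReal ?_
      have := sub_nonneg.2 hab
      rw [div_mul_eq_mul_div, mul_div_assoc', div_le_iff₀ (by positivity)]
      nlinarith

/-! ### Functions of one real variable with prescribed jets -/

/-- There are `C¹` functions of arbitrarily small total variation which agree with the identity
near the origin. -/
theorem exists_monotone_eq_id_near_zero {δ : ℝ} (hδ : 0 < δ) :
    ∃ (H : ℝ → ℝ) (ε : ℝ), 0 < ε ∧ ContDiff ℝ 1 H ∧ Monotone H ∧ (∀ t, |t| ≤ ε → H t = t) ∧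
      ∀ a b, a ≤ b → H b - H a ≤ δ := by
  -- a primitive of `1 / max 1 s²`, rescaled
  set g : ℝ → ℝ := fun s => (max 1 (s ^ 2))⁻¹ with hg
  have hpos : ∀ s : ℝ, 0 < max 1 (s ^ 2) := fun s => lt_max_of_lt_left one_pos
  have hgc : Continuous g := Continuous.inv₀ (by fun_prop) fun s => (hpos s).ne'
  have hg0 : ∀ s, 0 ≤ g s := fun s => inv_nonneg.2 (hpos s).le
  set G : ℝ → ℝ := fun t => ∫ s in (0 : ℝ)..t, g s with hG
  have hGd : ∀ t, HasDerivAt G (g t) t := fun t => hgc.integral_hasStrictDerivAt 0 t |>.hasDerivAt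
  have hGdiff : Differentiable ℝ G := fun t => (hGd t).differentiableAt
  have hGc : ContDiff ℝ 1 G := by
    rw [contDiff_one_iff_deriv]
    exact ⟨hGdiff, by rwa [funext fun t => (hGd t).deriv]⟩
  have hGm : Monotone G := monotone_of_deriv_nonneg hGdiff fun t => by
    rw [(hGd t).deriv]; exact hg0 t
  have hGid : ∀ t, |t| ≤ 1 → G t = t := by
    intro t ht
    have : ∫ s in (0 : ℝ)..t, g s = ∫ s in (0 : ℝ)..t, (1 : ℝ) := by
      refine intervalIntegral.integral_congr fun s hs => ?_
      have hs1 : |s| ≤ 1 := by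
        have := abs_sub_left_of_mem_uIcc hs
        simp only [sub_zero] at this
        exact this.trans ht
      have : s ^ 2 ≤ 1 := by rw [← sq_abs]; exact pow_le_one₀ (abs_nonneg s) hs1
      simp [hg, max_eq_left this]
    simp [hG, this]
  have hGb : ∀ a b, a ≤ b → G b - G a ≤ 2 * Real.pi := by
    intro a b hab
    have h1 : G b - G a = ∫ s in a..b, g s :=
      intervalIntegral.integral_interval_sub_left (hgc.intervalIntegrable _ _)
        (hgc.intervalIntegrable _ _)
    have hc : Continuous fun s : ℝ => 2 * (1 + s ^ 2)⁻¹ :=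
      continuous_const.mul (Continuous.inv₀ (by fun_prop) fun s => by positivity)
    have h2 : ∫ s in a..b, g s ≤ ∫ s in a..b, 2 * (1 + s ^ 2)⁻¹ := by
      refine intervalIntegral.integral_mono hab (hgc.intervalIntegrable _ _)
        (hc.intervalIntegrable _ _) fun s => ?_
      simp only [hg]
      rw [inv_le_iff_one_le_mul₀ (hpos s), ← div_eq_mul_inv, div_mul_eq_mul_div,
        le_div_iff₀ (by positivity)]
      have := le_max_left 1 (s ^ 2)
      have := le_max_right 1 (s ^ 2)
      linarith
    rw [intervalIntegral.integral_const_mul, integral_inv_one_add_sq] at h2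
    have := Real.arctan_lt_pi_div_two b
    have := Real.neg_pi_div_two_lt_arctan a
    rw [h1]
    linarith
  set ε := δ / (2 * Real.pi) with hε
  have hε0 : 0 < ε := by positivity
  refine ⟨fun t => ε * G (t / ε), ε, hε0, ?_, ?_, fun t ht => ?_, fun a b hab => ?_⟩
  · exact contDiff_const.mul (hGc.comp (contDiff_id.div_const ε))
  · intro a b hab
    exact mul_le_mul_of_nonneg_left (hGm (div_le_div_of_nonneg_right hab hε0.le)) hε0.le
  · change ε * G (t / ε) = t
    rw [hGid _ (by rw [abs_div, abs_of_pos hε0]; exact div_le_one_of_le₀ ht hε0.le)]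
    field_simp
  · have := mul_le_mul_of_nonneg_left
      (hGb (a / ε) (b / ε) (div_le_div_of_nonneg_right hab hε0.le)) hε0.le
    have h2 : ε * (2 * Real.pi) = δ := by rw [hε]; field_simp
    linarith

/-- The function `t ↦ t⁻¹` on `|t| ≥ ε` extends to a `C¹` function on the line. -/
theorem exists_contDiff_eq_inv {ε : ℝ} (hε : 0 < ε) :
    ∃ k : ℝ → ℝ, ContDiff ℝ 1 k ∧ ∀ t, ε ≤ |t| → t * k t = 1 := by
  set s : ℝ → ℝ := fun t => Real.smoothTransition (2 * t ^ 2 / ε ^ 2 - 1) with hs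
  have hsc : ContDiff ℝ 1 s :=
    (Real.smoothTransition.contDiff (n := 1)).comp (by fun_prop)
  refine ⟨fun t => s t * t⁻¹, contDiff_iff_contDiffAt.2 fun t => ?_, fun t ht => ?_⟩
  · rcases eq_or_ne t 0 with rfl | ht
    · -- near the origin the transition function vanishes
      have h0 : (fun t => s t * t⁻¹) =ᶠ[nhds 0] fun _ => 0 := by
        have : ContinuousAt (fun t : ℝ => 2 * t ^ 2 / ε ^ 2 - 1) 0 := by fun_prop
        filter_upwards [this.eventually_lt continuousAt_const
          (show (2 * (0 : ℝ) ^ 2 / ε ^ 2 - 1) < 0 by norm_num)] with x hx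
        simp [hs, Real.smoothTransition.zero_of_nonpos hx.le]
      exact contDiffAt_const.congr_of_eventuallyEq h0
    · exact hsc.contDiffAt.mul (contDiffAt_inv ℝ ht)
  · have ht0 : t ≠ 0 := by rintro rfl; simp at ht; linarith
    have h1 : ε ^ 2 ≤ t ^ 2 := by rw [← sq_abs t]; exact pow_le_pow_left₀ hε.le ht 2
    have : s t = 1 := by
      refine Real.smoothTransition.one_of_one_le ?_
      have : 1 ≤ t ^ 2 / ε ^ 2 := (one_le_div (by positivity)).2 h1
      have e : 2 * t ^ 2 / ε ^ 2 = 2 * (t ^ 2 / ε ^ 2) := by ring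
      linarith
    simp only [this, one_mul]
    exact mul_inv_cancel₀ ht0

/-- Point derivations are unbounded for the variation norm: there are polynomials `p` with
`p 0 = 0` and `p' 0 = 1` whose variation is as small as desired. -/
theorem exists_polynomial_small_variation (R : ℝ) {δ : ℝ} (hR : 0 < R) (hδ : 0 < δ) :
    ∃ p : Polynomial ℂ, p.coeff 0 = 0 ∧ p.coeff 1 = 1 ∧
      eVariationOn (fun t : ℝ => p.eval (t : ℂ)) (Icc (-R) R) ≤ ENNReal.ofReal δ := by
  obtain ⟨H, ε, hε, hHc, hHm, hHid, hHb⟩ := exists_monotone_eq_id_near_zero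
    (show 0 < δ / 4 by positivity)
  have hη : 0 < min (1 / 2) (δ / (8 * R)) := by positivity
  obtain ⟨q, -, hq', hq⟩ := exists_polynomial_near_contDiff hHc (-R) R hη
  set η := min (1 / 2) (δ / (8 * R))
  have hd : deriv H 0 = 1 := by
    have : H =ᶠ[nhds 0] id := by
      filter_upwards [Metric.ball_mem_nhds (0 : ℝ) hε] with x hx
      exact hHid x (by simpa using (mem_ball_zero_iff.1 hx).le)
    rw [this.deriv_eq, deriv_id]
  set c : ℝ := q.coeff 1 with hc
  have hqc : q.derivative.eval 0 = c := by
    rw [← Polynomial.coeff_zero_eq_eval_zero, Polynomial.coeff_derivative]; simp [hc]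
  have hc2 : 1 / 2 ≤ c := by
    have h1 := hq' 0 ⟨by linarith, hR.le⟩
    rw [hd, hqc] at h1
    have h2 := (abs_le.1 (h1.trans (min_le_left _ _))).1
    linarith
  have hc0 : c ≠ 0 := by linarith
  have hvq : eVariationOn (fun t : ℝ => ((q.eval t : ℝ) : ℂ)) (Icc (-R) R) ≤
      ENNReal.ofReal (δ / 2) := by
    have e : (fun t : ℝ => ((q.eval t : ℝ) : ℂ)) =
        fun t => (H t : ℂ) + (-1 : ℂ) * ((H t : ℂ) - (q.eval t : ℝ)) := by ext t; ring
    rw [e]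
    refine (eVariationOn_add_le _ _ _).trans ?_
    have h1 : eVariationOn (fun t => (H t : ℂ)) (Icc (-R) R) ≤ ENNReal.ofReal (δ / 4) :=
      ((eVariationOn_ofReal_le H _).trans (eVariationOn_le_of_monotone hHm (by linarith))).trans
        (ENNReal.ofReal_le_ofReal (hHb _ _ (by linarith)))
    have h2 : eVariationOn (fun t => (-1 : ℂ) * ((H t : ℂ) - (q.eval t : ℝ))) (Icc (-R) R) ≤
        ENNReal.ofReal (δ / 4) := by
      refine (eVariationOn_const_mul_le _ _ _).trans ?_
      rw [enorm_neg, enorm_one, one_mul]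
      refine hq.trans (ENNReal.ofReal_le_ofReal ?_)
      have := mul_le_mul_of_nonneg_right (min_le_right (1 / 2) (δ / (8 * R)))
        (show 0 ≤ R - -R by linarith)
      refine this.trans (le_of_eq ?_)
      field_simp
      ring
    refine (add_le_add h1 h2).trans (le_of_eq ?_)
    rw [← ENNReal.ofReal_add (by positivity) (by positivity)]
    congr 1
    ring
  refine ⟨Polynomial.C (c⁻¹ : ℂ) * (q.map Complex.ofRealHom - Polynomial.C (q.coeff 0 : ℂ)),
    by simp, ?_, ?_⟩
  · simp only [Polynomial.coeff_C_mul, Polynomial.coeff_sub, Polynomial.coeff_map,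
      Polynomial.coeff_C, one_ne_zero, if_false, sub_zero, ← hc]
    exact inv_mul_cancel₀ (by exact_mod_cast hc0)
  · have e : (fun t : ℝ => (Polynomial.C (c⁻¹ : ℂ) * (q.map Complex.ofRealHom -
        Polynomial.C (q.coeff 0 : ℂ))).eval (t : ℂ)) =
        fun t : ℝ => (c⁻¹ : ℂ) * (((q.eval t : ℝ) : ℂ) + -(q.coeff 0 : ℂ)) := by
      ext t
      have := Polynomial.eval_map_apply (f := Complex.ofRealHom) (p := q) t
      simp only [Complex.ofRealHom_eq_coe] at this
      rw [Polynomial.eval_mul, Polynomial.eval_sub, Polynomial.eval_C, Polynomial.eval_C, this,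
        sub_eq_add_neg]
    rw [e]
    refine (eVariationOn_const_mul_le _ _ _).trans ?_
    have h1 := eVariationOn_add_le (fun t : ℝ => ((q.eval t : ℝ) : ℂ))
      (fun _ => -(q.coeff 0 : ℂ)) (Icc (-R) R)
    rw [eVariationOn.constant_on (f := fun _ : ℝ => -(q.coeff 0 : ℂ))
      (by rintro _ ⟨_, _, rfl⟩ _ ⟨_, _, rfl⟩; rfl), add_zero] at h1
    have h2 : ‖(c⁻¹ : ℂ)‖ₑ ≤ ENNReal.ofReal 2 := by
      rw [← ofReal_norm]
      refine ENNReal.ofReal_le_ofReal ?_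
      rw [norm_inv, Complex.norm_real, Real.norm_eq_abs, abs_of_pos (by linarith)]
      rw [inv_le_comm₀ (by linarith) (by norm_num)]
      linarith
    refine (mul_le_mul' h2 (h1.trans hvq)).trans (le_of_eq ?_)
    rw [← ENNReal.ofReal_mul (by norm_num)]
    congr 1
    ring

/-! ### Well-bounded operators -/

section WellBounded

variable {X : Type*} [NormedAddCommGroup X] [NormedSpace ℂ X]

theorem IsWellBounded.exists_bound {A : X →L[ℂ] X} (hA : IsWellBounded A) :
    ∃ (R₀ : ℝ) (K : ℝ≥0), ∀ R ≥ R₀, ∀ p : Polynomial ℂ, ‖Polynomial.aeval A p‖ₑ ≤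
      K * (‖p.coeff 0‖ₑ + eVariationOn (fun t : ℝ => p.eval (t : ℂ)) (Icc (-R) R)) := by
  obtain ⟨a, b, K, hab, hK⟩ := hA
  refine ⟨max |a| |b|, 2 * K, fun R hR p => (hK p).trans ?_⟩
  have ha := abs_le.1 ((le_max_left _ _).trans hR)
  have hb := abs_le.1 ((le_max_right _ _).trans hR)
  set v := eVariationOn (fun t : ℝ => p.eval (t : ℂ)) (Icc (-R) R)
  have h1 : eVariationOn (fun t : ℝ => p.eval (t : ℂ)) (Icc a b) ≤ v :=
    eVariationOn.mono _ (Icc_subset_Icc ha.1 hb.2)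
  have h2 : ‖p.eval (b : ℂ)‖ₑ ≤ ‖p.coeff 0‖ₑ + v := by
    have := eVariationOn.edist_le (fun t : ℝ => p.eval (t : ℂ)) (s := Icc (-R) R) (x := b) (y := 0)
      hb (by constructor <;> linarith)
    rw [edist_eq_enorm_sub] at this
    rw [Polynomial.coeff_zero_eq_eval_zero]
    calc ‖p.eval (b : ℂ)‖ₑ = ‖p.eval 0 + (p.eval (b : ℂ) - p.eval 0)‖ₑ := by rw [add_sub_cancel]
      _ ≤ _ := (enorm_add_le _ _).trans (add_le_add le_rfl (by simpa using this))
  calc (K : ℝ≥0∞) * (‖p.eval (b : ℂ)‖ₑ + eVariationOn (fun t : ℝ => p.eval (t : ℂ)) (Icc a b))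
      ≤ K * ((‖p.coeff 0‖ₑ + v) + (‖p.coeff 0‖ₑ + v)) :=
        mul_le_mul_right (add_le_add h2 (h1.trans le_add_self)) _
    _ = _ := by push_cast; ring

theorem IsWellBounded.sub_algebraMap {A : X →L[ℂ] X} (hA : IsWellBounded A) (r : ℝ) :
    IsWellBounded (A - algebraMap ℂ (X →L[ℂ] X) r) := by
  obtain ⟨a, b, K, hab, hK⟩ := hA
  refine ⟨a - r, b - r, K, by linarith, fun p => ?_⟩
  have h := hK (p.comp (Polynomial.X - Polynomial.C (r : ℂ)))
  rw [Polynomial.aeval_comp] at h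
  have h2 : eVariationOn (fun t : ℝ => (p.comp (Polynomial.X - Polynomial.C (r : ℂ))).eval (t : ℂ))
      (Icc a b) ≤ eVariationOn (fun t : ℝ => p.eval (t : ℂ)) (Icc (a - r) (b - r)) := by
    refine le_trans (le_of_eq ?_) (eVariationOn.comp_le_of_monotoneOn
      (fun t : ℝ => p.eval (t : ℂ)) (fun t : ℝ => t - r) (t := Icc a b) ?_ ?_)
    · congr 1
      ext t
      simp
    · exact fun x _ y _ hxy => sub_le_sub_right hxy r
    · exact fun x hx => ⟨sub_le_sub_right hx.1 r, sub_le_sub_right hx.2 r⟩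
  have h3 : (p.comp (Polynomial.X - Polynomial.C (r : ℂ))).eval (b : ℂ) =
      p.eval ((b - r : ℝ) : ℂ) := by simp
  rw [h3] at h
  simp only [map_sub, Polynomial.aeval_X, Polynomial.aeval_C] at h
  exact h.trans (mul_le_mul_right (add_le_add le_rfl h2) _)

/-- Polynomials with prescribed first-order jet at the origin which are small on two given
well-bounded operators. -/
theorem IsWellBounded.exists_polynomial_small {A B : X →L[ℂ] X} (hA : IsWellBounded A)
    (hB : IsWellBounded B) {δ : ℝ} (hδ : 0 < δ) :
    ∃ p : Polynomial ℂ, p.coeff 0 = 0 ∧ p.coeff 1 = 1 ∧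
      ‖Polynomial.aeval A p‖ ≤ δ ∧ ‖Polynomial.aeval B p‖ ≤ δ := by
  obtain ⟨R₁, K₁, h₁⟩ := hA.exists_bound
  obtain ⟨R₂, K₂, h₂⟩ := hB.exists_bound
  set R := max 1 (max R₁ R₂)
  have hR : 0 < R := lt_max_of_lt_left one_pos
  set η : ℝ := δ / (K₁ + K₂ + 1) with hη
  have hη0 : 0 < η := by positivity
  obtain ⟨p, hp0, hp1, hp⟩ := exists_polynomial_small_variation R hR hη0
  have key : ∀ (C : X →L[ℂ] X) (K : ℝ≥0), (K : ℝ) ≤ K₁ + K₂ + 1 → ‖Polynomial.aeval C p‖ₑ ≤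
      K * (‖p.coeff 0‖ₑ + eVariationOn (fun t : ℝ => p.eval (t : ℂ)) (Icc (-R) R)) →
      ‖Polynomial.aeval C p‖ ≤ δ := by
    intro C K hK h
    rw [hp0, enorm_zero, zero_add] at h
    have h3 := h.trans (mul_le_mul_right hp _)
    rw [← ENNReal.ofReal_coe_nnreal, ← ENNReal.ofReal_mul K.coe_nonneg, ← ofReal_norm,
      ENNReal.ofReal_le_ofReal_iff (by positivity)] at h3
    refine h3.trans ((mul_le_mul_of_nonneg_right hK hη0.le).trans (le_of_eq ?_))
    rw [hη]
    field_simp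
  have hK₁ := K₁.coe_nonneg
  have hK₂ := K₂.coe_nonneg
  exact ⟨p, hp0, hp1,
    key A K₁ (by linarith) (h₁ R ((le_max_left _ _).trans (le_max_right _ _)) p),
    key B K₂ (by linarith) (h₂ R ((le_max_right _ _).trans (le_max_right _ _)) p)⟩

theorem Polynomial.exists_eq_C_add_X_mul_add_sq_mul (p : Polynomial ℂ) :
    ∃ q : Polynomial ℂ, p = Polynomial.C (p.coeff 0) +
      (Polynomial.C (p.coeff 1) + q * Polynomial.X) * Polynomial.X := by
  refine ⟨p.divX.divX, ?_⟩
  have h1 : Polynomial.C (p.coeff 1) + p.divX.divX * Polynomial.X = p.divX := by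
    have := Polynomial.divX_mul_X_add p.divX
    rw [Polynomial.coeff_divX] at this
    rw [add_comm]
    simpa using this
  rw [h1, add_comm]
  exact (Polynomial.divX_mul_X_add p).symm

/-- Modulo a closed left ideal, a nilpotent well-bounded operator vanishes, since
differentiation at the origin is not bounded by the variation norm. -/
theorem IsWellBounded.mem_of_pow_mem {A : X →L[ℂ] X} (hA : IsWellBounded A)
    {J : Submodule ℂ (X →L[ℂ] X)} (hJc : IsClosed (J : Set (X →L[ℂ] X)))
    (hJ : ∀ S, ∀ U ∈ J, S * U ∈ J) {m : ℕ} (hm : A ^ (m + 1) ∈ J) : A ∈ J := by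
  induction m with
  | zero => simpa using hm
  | succ m ih =>
    refine ih ?_
    rw [← SetLike.mem_coe, ← hJc.closure_eq, Metric.mem_closure_iff]
    intro ε hε
    obtain ⟨p, hp0, hp1, hp, -⟩ := hA.exists_polynomial_small hA
      (show 0 < ε / (‖A ^ m‖ + 1) / 2 by positivity)
    obtain ⟨q, hq⟩ := p.exists_eq_C_add_X_mul_add_sq_mul
    have e : Polynomial.aeval A p = A + Polynomial.aeval A q * A ^ 2 := by
      conv_lhs => rw [hq]
      simp [hp0, hp1]
      noncomm_ring
    have hc : Commute (Polynomial.aeval A q) A := by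
      simpa using (Commute.all q Polynomial.X).map (Polynomial.aeval A)
    refine ⟨A ^ (m + 1) - A ^ m * Polynomial.aeval A p, ?_, ?_⟩
    · rw [e, mul_add, ← pow_succ, sub_add_cancel_left, ← mul_assoc, ← (hc.pow_right m).eq, mul_assoc,
        ← pow_add, SetLike.mem_coe]
      exact J.neg_mem (hJ _ _ hm)
    · rw [dist_eq_norm, sub_sub_cancel]
      calc ‖A ^ m * Polynomial.aeval A p‖ ≤ ‖A ^ m‖ * (ε / (‖A ^ m‖ + 1) / 2) :=
            (norm_mul_le _ _).trans (mul_le_mul_of_nonneg_left hp (norm_nonneg _))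
        _ < ε := by
            rw [mul_div_assoc', mul_div_assoc', div_div, div_lt_iff₀ (by positivity)]
            nlinarith [norm_nonneg (A ^ m)]

variable [CompleteSpace X]

/-- The group `exp (i t A)` generated by a well-bounded operator grows at most linearly, as does
the variation of `s ↦ exp (i t s)` on a fixed interval. -/
theorem IsWellBounded.exists_norm_exp_le {A : X →L[ℂ] X} (hA : IsWellBounded A) :
    ∃ C : ℝ, 0 ≤ C ∧ ∀ t : ℝ, ‖NormedSpace.exp ((t * Complex.I : ℂ) • A)‖ ≤ C * (1 + |t|) := by
  obtain ⟨R₀, K, hK⟩ := hA.exists_bound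
  set R := max 1 R₀
  have hR : 0 < R := lt_max_of_lt_left one_pos
  refine ⟨K * (1 + 4 * R), by positivity, fun t => ?_⟩
  set c : ℂ := t * Complex.I with hc
  have hcn : ‖c‖ = |t| := by simp [hc]
  -- the Taylor polynomials of `s ↦ exp (c s)`
  let P : ℕ → Polynomial ℂ := fun N => ∑ n ∈ Finset.range N,
    Polynomial.C (c ^ n / n.factorial) * Polynomial.X ^ n
  have hPe : ∀ N s, (P N).eval s = ∑ n ∈ Finset.range N, (c * s) ^ n / n.factorial := by
    intro N s
    simp only [P, Polynomial.eval_finsetSum]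
    refine Finset.sum_congr rfl fun n _ => ?_
    simp
    ring
  have hPa : ∀ N, Polynomial.aeval A (P N) =
      ∑ n ∈ Finset.range N, ((n.factorial : ℂ)⁻¹) • (c • A) ^ n := by
    intro N
    simp only [P, map_sum]
    refine Finset.sum_congr rfl fun n _ => ?_
    rw [map_mul, Polynomial.aeval_C, map_pow, Polynomial.aeval_X, ← Algebra.smul_def, smul_pow,
      smul_smul, div_eq_inv_mul]
  have hP0 : ∀ N, (P (N + 1)).coeff 0 = 1 := by
    intro N
    rw [Polynomial.coeff_zero_eq_eval_zero, hPe, Finset.sum_range_succ']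
    simp
  have hP' : ∀ N, (P (N + 1)).derivative = Polynomial.C c * P N := by
    intro N
    simp only [P, Finset.sum_range_succ', Polynomial.derivative_add, Polynomial.derivative_sum,
      Finset.mul_sum]
    simp only [pow_zero, Nat.factorial_zero, Nat.cast_one, div_one, mul_one,
      Polynomial.derivative_C, add_zero]
    refine Finset.sum_congr rfl fun n _ => ?_
    rw [Polynomial.derivative_C_mul_X_pow, ← mul_assoc, ← Polynomial.C_mul]
    have : (n.factorial : ℂ) ≠ 0 := by exact_mod_cast n.factorial_ne_zero
    have h2 : (n : ℂ) + 1 ≠ 0 := by exact_mod_cast n.succ_ne_zero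
    simp only [Nat.factorial_succ, Nat.cast_mul, Nat.cast_add, Nat.cast_one, Nat.add_sub_cancel]
    congr 2
    field_simp
    rw [pow_succ']
  have htail : ∀ᶠ N in Filter.atTop, ∀ s ∈ Icc (-R) R, ‖(P N).eval (s : ℂ)‖ ≤ 2 := by
    have h1 : Filter.Tendsto (fun N => ∑ n ∈ Finset.range N, (|t| * R) ^ n / n.factorial)
        Filter.atTop (nhds (Real.exp (|t| * R))) := by
      have := (NormedSpace.expSeries_div_hasSum_exp (𝔸 := ℝ) (|t| * R)).tendsto_sum_nat
      rwa [← Real.exp_eq_exp_ℝ] at this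
    have h2 := h1.eventually (lt_mem_nhds (show Real.exp (|t| * R) - 1 < Real.exp (|t| * R) by
      linarith))
    filter_upwards [h2] with N hN s hs
    have hN' : Real.exp (|t| * R) - ∑ n ∈ Finset.range N, (|t| * R) ^ n / n.factorial ≤ 1 := by
      linarith
    have hcs : ‖c * s‖ ≤ |t| * R := by
      rw [norm_mul, hcn, Complex.norm_real, Real.norm_eq_abs]
      exact mul_le_mul_of_nonneg_left (abs_le.2 hs) (abs_nonneg t)
    -- the Taylor remainder of the exponential is increasing in the modulus
    have h3 : ‖Complex.exp (c * s) - (P N).eval (s : ℂ)‖ ≤ 1 := by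
      rw [hPe]
      refine le_trans ?_ hN'
      have e1 : ∀ x : ℝ, HasSum (fun n : ℕ => x ^ (n + N) / (n + N).factorial)
          (Real.exp x - ∑ n ∈ Finset.range N, x ^ n / n.factorial) := fun x => by
        have := NormedSpace.expSeries_div_hasSum_exp (𝔸 := ℝ) x
        rw [← Real.exp_eq_exp_ℝ] at this
        exact (hasSum_nat_add_iff' N).2 this
      refine (Complex.norm_exp_sub_sum_le_exp_norm_sub_sum (c * s) N).trans
        (hasSum_le (fun n => ?_) (e1 _) (e1 _))
      exact div_le_div_of_nonneg_right (pow_le_pow_left₀ (norm_nonneg _) hcs _) (by positivity)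
    have h4 : ‖Complex.exp (c * s)‖ = 1 := by
      rw [Complex.norm_exp]
      simp [hc]
    calc ‖(P N).eval (s : ℂ)‖ =
          ‖Complex.exp (c * s) - (Complex.exp (c * s) - (P N).eval (s : ℂ))‖ := by
            rw [sub_sub_cancel]
      _ ≤ 1 + 1 := (norm_sub_le _ _).trans (add_le_add h4.le h3)
      _ = 2 := by norm_num
  have hlim : Filter.Tendsto (fun N => Polynomial.aeval A (P (N + 1))) Filter.atTop
      (nhds (NormedSpace.exp (c • A))) := by
    have := (NormedSpace.exp_series_hasSum_exp' (𝕂 := ℂ) (c • A)).tendsto_sum_nat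
    simp only [← hPa] at this
    exact this.comp (Filter.tendsto_add_atTop_nat 1)
  refine le_of_tendsto hlim.norm ?_
  filter_upwards [htail] with N hN
  have hv : eVariationOn (fun s : ℝ => (P (N + 1)).eval (s : ℂ)) (Icc (-R) R) ≤
      ENNReal.ofReal (|t| * 2 * (R - -R)) := by
    refine eVariationOn_le_of_norm_deriv_le (by positivity)
      (f' := fun s : ℝ => (P (N + 1)).derivative.eval (s : ℂ)) (fun s _ => ?_) fun s hs => ?_
    · exact ((P (N + 1)).hasDerivAt (s : ℂ)).comp_ofReal
    · rw [hP', Polynomial.eval_mul, Polynomial.eval_C, norm_mul, hcn]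
      exact mul_le_mul_of_nonneg_left (hN s hs) (abs_nonneg t)
  have h := (hK R (le_max_right _ _) (P (N + 1))).trans
    (mul_le_mul_right (add_le_add le_rfl hv) _)
  rw [hP0, enorm_one, ← ENNReal.ofReal_one, ← ENNReal.ofReal_add (by norm_num)
    (by have := abs_nonneg t; nlinarith [mul_nonneg this hR.le]), ← ENNReal.ofReal_coe_nnreal,
    ← ENNReal.ofReal_mul K.coe_nonneg, ← ofReal_norm,
    ENNReal.ofReal_le_ofReal_iff (by
      have := mul_nonneg (abs_nonneg t) hR.le
      have h2 : 0 ≤ 1 + |t| * 2 * (R - -R) := by nlinarith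
      exact mul_nonneg K.coe_nonneg h2)] at h
  refine h.trans ?_
  rw [mul_assoc (K : ℝ)]
  refine mul_le_mul_of_nonneg_left ?_ K.coe_nonneg
  nlinarith [abs_nonneg t]

end WellBounded

/-! ### Commuting well-bounded operators modulo a closed left ideal -/

section Splitting

variable {X : Type*} [NormedAddCommGroup X] [NormedSpace ℂ X] [CompleteSpace X]

/-- If `N` is nilpotent modulo a left ideal annihilated by the functional `φ`, then
`φ (S * exp (x N))` is a polynomial in `x`; hence the bound. -/
theorem norm_apply_mul_exp_le {J : Submodule ℂ (X →L[ℂ] X)} (hJ : ∀ S, ∀ U ∈ J, S * U ∈ J)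
    {φ : (X →L[ℂ] X) →L[ℂ] ℂ} (hφ : ∀ U ∈ J, φ U = 0) {N : X →L[ℂ] X} {k : ℕ} (hN : N ^ k ∈ J)
    (S : X →L[ℂ] X) (x : ℝ) :
    ‖φ (S * NormedSpace.exp ((x : ℂ) • N))‖ ≤
      ‖φ‖ * ‖S‖ * (∑ j ∈ Finset.range k, ‖N ^ j‖) * (1 + |x|) ^ k := by
  have h1 := (NormedSpace.exp_series_hasSum_exp' (𝕂 := ℂ) ((x : ℂ) • N)).mapL
    (φ.comp (ContinuousLinearMap.mul ℂ (X →L[ℂ] X) S))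
  simp only [ContinuousLinearMap.comp_apply, ContinuousLinearMap.mul_apply'] at h1
  have h2 : ∀ j ∉ Finset.range k, φ (S * ((j.factorial : ℂ)⁻¹ • ((x : ℂ) • N) ^ j)) = 0 := by
    intro j hj
    rw [Finset.mem_range, not_lt] at hj
    apply hφ
    rw [smul_pow, ← Nat.sub_add_cancel hj, pow_add N, smul_smul, mul_smul_comm, ← mul_assoc]
    exact J.smul_mem _ (hJ _ _ hN)
  rw [h1.unique (hasSum_sum_of_ne_finset_zero h2), Finset.mul_sum, Finset.sum_mul]
  refine (norm_sum_le _ _).trans (Finset.sum_le_sum fun j hj => ?_)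
  have h3 : ‖(j.factorial : ℂ)⁻¹‖ ≤ 1 := by
    rw [norm_inv, Complex.norm_natCast]
    exact inv_le_one_of_one_le₀ (by exact_mod_cast j.factorial_pos)
  have h4 : |x| ^ j ≤ (1 + |x|) ^ k :=
    (pow_le_pow_left₀ (abs_nonneg x) (by linarith) j).trans
      (pow_le_pow_right₀ (by linarith [abs_nonneg x]) (Finset.mem_range.1 hj).le)
  have h5 : ‖((j.factorial : ℂ)⁻¹ • ((x : ℂ) • N) ^ j)‖ ≤ ‖N ^ j‖ * (1 + |x|) ^ k := by
    rw [smul_pow, norm_smul, norm_smul, norm_pow, Complex.norm_real, Real.norm_eq_abs]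
    calc ‖(j.factorial : ℂ)⁻¹‖ * (|x| ^ j * ‖N ^ j‖) ≤ 1 * ((1 + |x|) ^ k * ‖N ^ j‖) := by gcongr
      _ = _ := by ring
  calc ‖φ (S * ((j.factorial : ℂ)⁻¹ • ((x : ℂ) • N) ^ j))‖
      ≤ ‖φ‖ * (‖S‖ * (‖N ^ j‖ * (1 + |x|) ^ k)) :=
        (φ.le_opNorm _).trans (mul_le_mul_of_nonneg_left ((norm_mul_le _ _).trans
          (mul_le_mul_of_nonneg_left h5 (norm_nonneg _))) (norm_nonneg _))
    _ = _ := by ring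

theorem iteratedDeriv_apply_exp_smul (φ : (X →L[ℂ] X) →L[ℂ] ℂ) (A : X →L[ℂ] X) (m : ℕ) :
    iteratedDeriv m (fun z : ℂ => φ (NormedSpace.exp (z • A))) =
      fun z : ℂ => φ (A ^ m * NormedSpace.exp (z • A)) := by
  induction m with
  | zero => simp
  | succ m ih =>
    rw [iteratedDeriv_succ, ih]
    ext z
    have h1 := hasDerivAt_exp_smul_const' (𝕂 := ℂ) A z
    have h2 := (φ.comp (ContinuousLinearMap.mul ℂ (X →L[ℂ] X) (A ^ m))).hasFDerivAt.comp_hasDerivAt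
      z h1
    simp only [ContinuousLinearMap.comp_apply, ContinuousLinearMap.mul_apply'] at h2
    rw [pow_succ, mul_assoc]
    exact h2.deriv

/-- A Liouville argument: an entire function `z ↦ φ (exp (z A))` of polynomial growth is a
polynomial, so `φ` kills the high powers of `A`. -/
theorem apply_pow_eq_zero_of_growth {φ : (X →L[ℂ] X) →L[ℂ] ℂ} {A : X →L[ℂ] X} {C : ℝ} {d : ℕ}
    (h : ∀ z : ℂ, ‖φ (NormedSpace.exp (z • A))‖ ≤ C * (1 + ‖z‖) ^ d) : φ (A ^ (d + 1)) = 0 := by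
  have hC : 0 ≤ C := by simpa using (norm_nonneg _).trans (h 0)
  have hd : Differentiable ℂ (fun z : ℂ => φ (NormedSpace.exp (z • A))) := fun z =>
    (φ.hasFDerivAt.comp_hasDerivAt z (hasDerivAt_exp_smul_const' (𝕂 := ℂ) A z)).differentiableAt
  have key : ∀ R : ℝ, 1 ≤ R → ‖φ (A ^ (d + 1))‖ * R ≤ (d + 1).factorial * C * 2 ^ d := by
    intro R hR
    have hR0 : 0 < R := by linarith
    have h1 := Complex.norm_iteratedDeriv_le_of_forall_mem_sphere_norm_le (c := 0) (R := R)
      (C := C * (2 * R) ^ d) (d + 1) hR0 hd.diffContOnCl (fun z hz => by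
        refine (h z).trans (mul_le_mul_of_nonneg_left (pow_le_pow_left₀ (by positivity) ?_ d) hC)
        rw [mem_sphere_zero_iff_norm.1 hz]
        linarith)
    rw [iteratedDeriv_apply_exp_smul] at h1
    simp only [zero_smul, NormedSpace.exp_zero, mul_one] at h1
    rw [le_div_iff₀ (by positivity), mul_pow, pow_succ] at h1
    have hRd : 0 < R ^ d := by positivity
    refine le_of_mul_le_mul_right ?_ hRd
    calc _ = ‖φ (A ^ (d + 1))‖ * (R ^ d * R) := by ring
      _ ≤ _ := h1
      _ = _ := by ring
  by_contra hne
  have hpos : 0 < ‖φ (A ^ (d + 1))‖ := norm_pos_iff.2 hne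
  set M := (d + 1).factorial * C * 2 ^ d
  have hM : 0 ≤ M := by positivity
  have := key (M / ‖φ (A ^ (d + 1))‖ + 1) (by have : 0 ≤ M / ‖φ (A ^ (d + 1))‖ := by positivity
                                              linarith)
  rw [mul_add, mul_div_cancel₀ _ hpos.ne'] at this
  linarith

theorem Submodule.mem_of_forall_functional_eq_zero {E : Type*} [NormedAddCommGroup E]
    [NormedSpace ℂ E] {J : Submodule ℂ E} (hJ : IsClosed (J : Set E)) {x : E}
    (h : ∀ φ : E →L[ℂ] ℂ, (∀ y ∈ J, φ y = 0) → φ x = 0) : x ∈ J := by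
  have : IsClosed (J : Set E) := hJ
  rw [← Submodule.Quotient.mk_eq_zero]
  refine SeparatingDual.eq_zero_of_forall_dual_eq_zero (R := ℂ) fun f => ?_
  refine h (f.comp J.mkQL) fun y hy => ?_
  have : J.mkQL y = 0 := (Submodule.Quotient.mk_eq_zero J).2 hy
  rw [ContinuousLinearMap.comp_apply, this, map_zero]

/-- Let `A`, `B` be commuting well-bounded operators and let `J` be a closed left ideal. If
`A + i B` is nilpotent modulo `J`, then `A` belongs to `J`.

Indeed `exp (x A) = exp (x (A + i B)) exp (-i x B)` grows polynomially modulo `J` in the real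
direction, just as `exp (i y A)` does in the imaginary one, so that the Liouville theorem applies
to `exp (z A)` modulo `J`. -/
theorem IsWellBounded.mem_of_add_I_smul_pow_mem {A B : X →L[ℂ] X} (hA : IsWellBounded A)
    (hB : IsWellBounded B) (hAB : Commute A B) {J : Submodule ℂ (X →L[ℂ] X)}
    (hJc : IsClosed (J : Set (X →L[ℂ] X))) (hJ : ∀ S, ∀ U ∈ J, S * U ∈ J) {k : ℕ}
    (hN : (A + Complex.I • B) ^ k ∈ J) : A ∈ J := by
  obtain ⟨a, ha0, ha⟩ := hA.exists_norm_exp_le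
  obtain ⟨b, hb0, hb⟩ := hB.exists_norm_exp_le
  set N := A + Complex.I • B with hNdef
  refine hA.mem_of_pow_mem hJc hJ (m := k + 2) ?_
  refine Submodule.mem_of_forall_functional_eq_zero hJc fun φ hφ => ?_
  set M := ∑ j ∈ Finset.range k, ‖N ^ j‖
  have hM : 0 ≤ M := Finset.sum_nonneg fun _ _ => norm_nonneg _
  refine apply_pow_eq_zero_of_growth (C := ‖φ‖ * (a * b) * M) fun z => ?_
  have hBN : Commute B N := hAB.symm.add_right ((Commute.refl B).smul_right _)
  have hAN : Commute A N := (Commute.refl A).add_right (hAB.smul_right _)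
  have e : z • A = (((z.im : ℝ) * Complex.I : ℂ) • A + (((-z.re : ℝ) : ℂ) * Complex.I) • B) +
      (z.re : ℂ) • N := by
    conv_lhs => rw [← Complex.re_add_im z]
    rw [hNdef, smul_add, smul_smul, add_smul]
    push_cast
    module
  have e2 : NormedSpace.exp (z • A) = (NormedSpace.exp (((z.im : ℝ) * Complex.I : ℂ) • A) *
      NormedSpace.exp ((((-z.re : ℝ) : ℂ) * Complex.I) • B)) *
        NormedSpace.exp ((z.re : ℂ) • N) := by
    let : NormedAlgebra ℚ (X →L[ℂ] X) := NormedAlgebra.restrictScalars ℚ ℂ (X →L[ℂ] X)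
    rw [e, NormedSpace.exp_add_of_commute, NormedSpace.exp_add_of_commute]
    · exact (hAB.smul_left _).smul_right _
    · exact ((hAN.smul_left _).smul_right _).add_left ((hBN.smul_left _).smul_right _)
  rw [e2]
  refine (norm_apply_mul_exp_le hJ hφ hN _ z.re).trans ?_
  have h1 : ‖NormedSpace.exp (((z.im : ℝ) * Complex.I : ℂ) • A)‖ ≤ a * (1 + ‖z‖) :=
    (ha z.im).trans (mul_le_mul_of_nonneg_left (by linarith [Complex.abs_im_le_norm z]) ha0)
  have h2 : ‖NormedSpace.exp ((((-z.re : ℝ) : ℂ) * Complex.I) • B)‖ ≤ b * (1 + ‖z‖) := by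
    refine (hb (-z.re)).trans (mul_le_mul_of_nonneg_left ?_ hb0)
    rw [abs_neg]
    linarith [Complex.abs_re_le_norm z]
  have h3 := (norm_mul_le _ _).trans (mul_le_mul h1 h2 (norm_nonneg _) (by positivity))
  have h4 : (1 + |z.re|) ^ k ≤ (1 + ‖z‖) ^ k :=
    pow_le_pow_left₀ (by positivity) (by linarith [Complex.abs_re_le_norm z]) k
  calc _ ≤ ‖φ‖ * (a * (1 + ‖z‖) * (b * (1 + ‖z‖))) * M * (1 + ‖z‖) ^ k := by gcongr
    _ = _ := by ring

/-- Commuting well-bounded operators act on the generalised eigenvectors of `A + i B` by scalars. -/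
theorem IsWellBounded.apply_eq_of_pow_apply_eq_zero {A B : X →L[ℂ] X} (hA : IsWellBounded A)
    (hB : IsWellBounded B) (hAB : Commute A B) {μ : ℂ} {k : ℕ} {x : X}
    (hx : ((A + Complex.I • B - algebraMap ℂ (X →L[ℂ] X) μ) ^ k) x = 0) :
    A x = (μ.re : ℂ) • x := by
  have h1 := (hA.sub_algebraMap μ.re).mem_of_add_I_smul_pow_mem (hB.sub_algebraMap μ.im)
    (J := LinearMap.ker ((ContinuousLinearMap.apply ℂ X x).toLinearMap)) (k := k)
    (((hAB.sub_right (Algebra.commutes _ _).symm)).sub_left (Algebra.commutes _ _))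
    (ContinuousLinearMap.isClosed_ker _) (fun S U hU => by
      have hU : U x = 0 := hU
      change S (U x) = 0
      rw [hU, map_zero]) (by
      have e : A - algebraMap ℂ (X →L[ℂ] X) μ.re +
          Complex.I • (B - algebraMap ℂ (X →L[ℂ] X) μ.im) =
          A + Complex.I • B - algebraMap ℂ (X →L[ℂ] X) μ := by
        conv_rhs => rw [← Complex.re_add_im μ]
        simp only [Algebra.algebraMap_eq_smul_one]
        module
      rw [e]
      exact hx)
  have h2 : (A - algebraMap ℂ (X →L[ℂ] X) μ.re) x = 0 := h1
  rw [Algebra.algebraMap_eq_smul_one] at h2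
  simpa [sub_eq_zero] using h2

/-- The real part of a compact operator `A + i B`, with `A`, `B` commuting and well-bounded, is
compact. -/
theorem IsWellBounded.isCompactOperator_of_add_I_smul {A B : X →L[ℂ] X} (hA : IsWellBounded A)
    (hB : IsWellBounded B) (hAB : Commute A B) (h : IsCompactOperator (A + Complex.I • B)) :
    IsCompactOperator A :=
  hA.mem_of_add_I_smul_pow_mem hB hAB (J := compactOperator (RingHom.id ℂ) X X) (k := 1)
    isClosed_setOfPred_isCompactOperator
    (fun S U (hU : IsCompactOperator U) => hU.clm_comp S) (by rw [pow_one]; exact h)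

/-- The eigenspace at `1` of a compact operator is finite-dimensional. -/
theorem finiteDimensional_ker_sub_one {S : X →L[ℂ] X} (hS : IsCompactOperator S) :
    FiniteDimensional ℂ (LinearMap.ker (S - 1).toLinearMap) := by
  set V := LinearMap.ker (S - 1).toLinearMap
  have hV : ∀ v ∈ V, S v = v := fun v hv => by
    have : S v - v = 0 := hv
    exact sub_eq_zero.1 this
  have hVc : IsClosed (V : Set X) := (S - 1).isClosed_ker
  have : CompleteSpace V := hVc.completeSpace_coe
  have h1 := IsCompactOperator.restrict' (f := S.toLinearMap) hS (V := V)
    fun v hv => by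
      have h : S v = v := hV v hv
      change S v ∈ V
      rwa [h]
  refine FiniteDimensional.of_isCompactOperator_id (𝕜 := ℂ) ?_
  rwa [show (⇑(S.toLinearMap.restrict _) : V → V) = id from
    funext fun v => Subtype.ext (hV v v.2)] at h1

/-- If two splittings of `T` into commuting well-bounded parts are given, their real parts agree
on the space of fixed vectors of a compact operator commuting with `T`. -/
theorem IsWellBounded.eqOn_ker_sub_one {A B A' B' S : X →L[ℂ] X} (hA : IsWellBounded A)
    (hB : IsWellBounded B) (hAB : Commute A B) (hA' : IsWellBounded A') (hB' : IsWellBounded B')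
    (hAB' : Commute A' B') (hT : A + Complex.I • B = A' + Complex.I • B')
    (hS : IsCompactOperator S) (hST : Commute S (A + Complex.I • B)) {x : X} (hx : S x = x) :
    A x = A' x := by
  set T := A + Complex.I • B with hTdef
  set V := LinearMap.ker (S - 1).toLinearMap
  have : FiniteDimensional ℂ V := finiteDimensional_ker_sub_one hS
  have hTV : ∀ v ∈ V, T.toLinearMap v ∈ V := fun v hv => by
    have h1 : S v - v = 0 := hv
    have h2 : S (T v) = T (S v) := DFunLike.congr_fun hST.eq v
    change S (T v) - T v = 0
    rw [h2, ← map_sub, h1, map_zero]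
  set f : Module.End ℂ V := T.toLinearMap.restrict hTV
  have hpow : ∀ (μ : ℂ) (k : ℕ) (v : V), (((f - algebraMap ℂ (Module.End ℂ V) μ) ^ k) v : X) =
      ((T - algebraMap ℂ (X →L[ℂ] X) μ) ^ k) (v : X) := by
    intro μ k
    induction k with
    | zero => intro v; simp
    | succ k ih =>
      intro v
      rw [pow_succ, pow_succ, Module.End.mul_apply, mul_apply_eq_comp, ih]
      congr 1
  have htop := Module.End.iSup_maxGenEigenspace_eq_top f
  have hx' : (⟨x, by change S x - x = 0; rw [hx, sub_self]⟩ : V) ∈ ⨆ μ, f.maxGenEigenspace μ := by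
    rw [htop]; trivial
  refine Submodule.iSup_induction _ (motive := fun v : V => A v = A' v) hx' ?_ (by simp) ?_
  · intro μ v hv
    obtain ⟨k, hk⟩ := (Module.End.mem_maxGenEigenspace _ _ _).1 hv
    have h0 : ((T - algebraMap ℂ (X →L[ℂ] X) μ) ^ k) (v : X) = 0 := by
      rw [← hpow, Algebra.algebraMap_eq_smul_one, hk, Submodule.coe_zero]
    rw [hA.apply_eq_of_pow_apply_eq_zero hB hAB h0,
      hA'.apply_eq_of_pow_apply_eq_zero hB' hAB' (hT ▸ h0)]
  · intro v w hv hw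
    simp [hv, hw]

end Splitting

/-! ### Uniqueness of the splitting -/

section FunctionalCalculus

variable {X : Type*} [NormedAddCommGroup X] [NormedSpace ℂ X] {σ : Set ℂ}

theorem IsCompact.exists_planeFunctional_mem_Icc (hσ : IsCompact σ) (α β : ℝ) :
    ∃ R : ℝ, 0 < R ∧ ∀ z ∈ σ, planeFunctional α β z ∈ Icc (-R) R := by
  obtain ⟨C, hC⟩ := hσ.exists_bound_of_continuousOn
    (continuous_planeFunctional α β).continuousOn
  exact ⟨max C 1, by positivity, fun z hz => abs_le.1 ((hC z hz).trans (le_max_left _ _))⟩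

theorem planeFunctional_mem_AC (hσ : IsCompact σ) {α β : ℝ} (hαβ : α ≠ 0 ∨ β ≠ 0) :
    (fun z : σ => (planeFunctional α β z : ℂ)) ∈ AC σ := by
  obtain ⟨R, hR, hR'⟩ := hσ.exists_planeFunctional_mem_Icc α β
  exact ridge_mem_AC (h := fun t => t) hαβ (by linarith : -R ≤ R) hR' contDiff_id

/-- Under an `AC(σ)` functional calculus, real linear functionals give well-bounded operators. -/
theorem isWellBounded_map_planeFunctional (hσ : IsCompact σ) {ψ : AC σ →ₐ[ℂ] (X →L[ℂ] X)}
    {K : ℝ≥0} (hψ : ∀ f : AC σ, ‖ψ f‖ₑ ≤ K * bvENorm (f : σ → ℂ)) {α β : ℝ}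
    (hαβ : α ≠ 0 ∨ β ≠ 0) {l : AC σ}
    (hl : (l : σ → ℂ) = fun z : σ => (planeFunctional α β z : ℂ)) : IsWellBounded (ψ l) := by
  obtain ⟨R, hR, hR'⟩ := hσ.exists_planeFunctional_mem_Icc α β
  refine ⟨-R, R, 2 * K, by linarith, fun p => ?_⟩
  have e : ((Polynomial.aeval l p : AC σ) : σ → ℂ) =
      fun z : σ => p.eval (planeFunctional α β z : ℂ) := by
    rw [← aeval_planeFunctional, ← hl]
    exact (Polynomial.aeval_algHom_apply (AC σ).val l p).symm
  rw [Polynomial.aeval_algHom_apply]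
  refine (hψ _).trans ?_
  rw [e]
  have h := bvENorm_ridge_le hαβ hR' (right_mem_Icc.2 (by linarith : -R ≤ R))
    (fun t : ℝ => p.eval (t : ℂ))
  calc _ ≤ (K : ℝ≥0∞) * (2 * ‖p.eval (R : ℂ)‖ₑ +
        2 * eVariationOn (fun t : ℝ => p.eval (t : ℂ)) (Icc (-R) R)) :=
        mul_le_mul_right (h.trans (add_le_add (le_mul_of_one_le_left' (by norm_num)) le_rfl)) _
    _ = _ := by push_cast; ring

/-- Let `ψ` be an `AC(σ)` functional calculus taking a real linear functional to a compact
operator `C`. An operator which vanishes on the fixed vectors of every compact operator in the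
range of `ψ` vanishes on the range of `C`.

Indeed `C` is the norm limit of the operators `f(C)` with `f` vanishing near the origin, and
`f(C)` maps into the fixed vectors of `C k(C)` when `t k(t) = 1` on the support of `f`. -/
theorem mul_map_planeFunctional_eq_zero (hσ : IsCompact σ) {ψ : AC σ →ₐ[ℂ] (X →L[ℂ] X)}
    {K : ℝ≥0} (hψ : ∀ f : AC σ, ‖ψ f‖ₑ ≤ K * bvENorm (f : σ → ℂ)) {α β : ℝ}
    (hαβ : α ≠ 0 ∨ β ≠ 0) {l : AC σ}
    (hl : (l : σ → ℂ) = fun z : σ => (planeFunctional α β z : ℂ))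
    (hc : IsCompactOperator (ψ l)) {D : X →L[ℂ] X}
    (hD : ∀ s : AC σ, IsCompactOperator (ψ s) → ∀ x, ψ s x = x → D x = 0) : D * ψ l = 0 := by
  obtain ⟨R, hR, hR'⟩ := hσ.exists_planeFunctional_mem_Icc α β
  have key : ∀ δ : ℝ, 0 < δ → ‖D * ψ l‖ ≤ ‖D‖ * (K * (2 * δ)) := by
    intro δ hδ
    obtain ⟨H, ε, hε, hHc, hHm, hHid, hHb⟩ := exists_monotone_eq_id_near_zero hδ
    obtain ⟨k, hkc, hk⟩ := exists_contDiff_eq_inv hε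
    let h : AC σ := ⟨_, ridge_mem_AC hαβ (by linarith) hR' hHc⟩
    let κ : AC σ := ⟨_, ridge_mem_AC hαβ (by linarith) hR' hkc⟩
    have h1 : l * κ * (l - h) = l - h := by
      apply Subtype.ext
      ext z
      change (l : σ → ℂ) z * (k (planeFunctional α β z) : ℂ) *
        ((l : σ → ℂ) z - (H (planeFunctional α β z) : ℂ)) =
        (l : σ → ℂ) z - (H (planeFunctional α β z) : ℂ)
      rw [hl]
      dsimp only
      rcases le_total |planeFunctional α β z| ε with ht | ht
      · rw [hHid _ ht, sub_self, mul_zero]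
      · rw [← Complex.ofReal_mul, hk _ ht, Complex.ofReal_one, one_mul]
    have hcomp : IsCompactOperator (ψ (l * κ)) := by
      rw [map_mul]
      exact hc.comp_clm (ψ κ)
    have h2 : D * ψ (l - h) = 0 := by
      ext x
      refine hD (l * κ) hcomp _ ?_
      conv_rhs => rw [← h1, map_mul]
      rfl
    have h3 : ‖ψ h‖ ≤ K * (2 * δ) := by
      have h4 := bvENorm_ridge_le hαβ hR' (c := 0) (by constructor <;> linarith)
        (fun t : ℝ => (H t : ℂ))
      rw [hHid 0 (by simpa using hε.le), Complex.ofReal_zero, enorm_zero, zero_add] at h4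
      have h5 := (eVariationOn_ofReal_le H (Icc (-R) R)).trans
        ((eVariationOn_le_of_monotone hHm (by linarith)).trans
          (ENNReal.ofReal_le_ofReal (hHb _ _ (by linarith))))
      have h6 := (hψ h).trans (mul_le_mul_right (h4.trans (mul_le_mul_right h5 _)) _)
      rwa [← ENNReal.ofReal_ofNat 2, ← ENNReal.ofReal_mul (by norm_num),
        ← ENNReal.ofReal_coe_nnreal, ← ENNReal.ofReal_mul K.coe_nonneg, ← ofReal_norm,
        ENNReal.ofReal_le_ofReal_iff (by positivity)] at h6
    have h7 : D * ψ l = D * ψ h := by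
      rw [map_sub, mul_sub, sub_eq_zero] at h2
      exact h2
    rw [h7]
    exact (norm_mul_le _ _).trans (mul_le_mul_of_nonneg_left h3 (norm_nonneg _))
  refine norm_le_zero_iff.1 (le_of_forall_pos_le_add fun η hη => ?_)
  refine (key (η / (‖D‖ * (K * 2) + 1)) (by positivity)).trans ?_
  rw [zero_add]
  calc ‖D‖ * (K * (2 * (η / (‖D‖ * (K * 2) + 1)))) =
        (‖D‖ * (K * 2)) / (‖D‖ * (K * 2) + 1) * η := by ring
    _ ≤ 1 * η := by
        refine mul_le_mul_of_nonneg_right ?_ hη.le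
        exact div_le_one_of_le₀ (by linarith) (by positivity)
    _ = η := one_mul η

/-- If the difference `D = A - A'` of two well-bounded operators satisfies `A D = A' D = D A' = 0`,
then `D = 0`: all powers of `A` and `A'` beyond the first coincide, so that
`p(A) = p(A') + p'(0) D` for every polynomial `p`. -/
theorem IsWellBounded.eq_of_mul_sub_eq_zero {A A' : X →L[ℂ] X} (hA : IsWellBounded A)
    (hA' : IsWellBounded A') (h1 : A * (A - A') = 0) (h2 : A' * (A - A') = 0)
    (h3 : (A - A') * A' = 0) : A = A' := by
  have hsq : A ^ 2 = A' ^ 2 := by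
    have e1 : A * A = A * A' := by rwa [mul_sub, sub_eq_zero] at h1
    have e3 : A * A' = A' * A' := by rwa [sub_mul, sub_eq_zero] at h3
    rw [pow_two, pow_two, e1, e3]
  have hcube : ∀ n, A ^ (n + 2) = A' ^ (n + 2) := by
    intro n
    induction n with
    | zero => exact hsq
    | succ n ih =>
      have e2 : A' * A = A' * A' := by rwa [mul_sub, sub_eq_zero] at h2
      rw [pow_succ A, show n + 1 + 1 = n + 2 from rfl, ih, pow_succ A', mul_assoc, e2,
        ← mul_assoc, ← pow_succ, ← pow_succ]
  have hq : ∀ q : Polynomial ℂ,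
      Polynomial.aeval A q * A ^ 2 = Polynomial.aeval A' q * A' ^ 2 := by
    intro q
    induction q using Polynomial.induction_on' with
    | add p q hp hq => rw [map_add, map_add, add_mul, add_mul, hp, hq]
    | monomial n c =>
      rw [Polynomial.aeval_monomial, Polynomial.aeval_monomial, mul_assoc, mul_assoc, ← pow_add,
        ← pow_add, hcube]
  refine sub_eq_zero.1 (norm_le_zero_iff.1 (le_of_forall_pos_le_add fun δ hδ => ?_))
  obtain ⟨p, hp0, hp1, hpA, hpA'⟩ := hA.exists_polynomial_small hA' (half_pos hδ)
  obtain ⟨q, hpq⟩ := p.exists_eq_C_add_X_mul_add_sq_mul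
  have e : ∀ C : X →L[ℂ] X, Polynomial.aeval C p = C + Polynomial.aeval C q * C ^ 2 := fun C => by
    conv_lhs => rw [hpq]
    simp [hp0, hp1]
    noncomm_ring
  have e' : A - A' = Polynomial.aeval A p - Polynomial.aeval A' p := by
    rw [e, e, hq, add_sub_add_right_eq_sub]
  rw [e', zero_add]
  exact (norm_sub_le _ _).trans (by linarith)

end FunctionalCalculus

theorem mainTheorem5 {X : Type*} [NormedAddCommGroup X] [NormedSpace ℂ X] [CompleteSpace X]
    (σ : Set ℂ) (hσ : IsCompact σ) (hσ' : σ.Nonempty)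
    (T A B : X →L[ℂ] X) (hT : IsACOperator σ T) (hTc : IsCompactOperator T)
    (hA : IsWellBounded A) (hB : IsWellBounded B) (hAB : Commute A B)
    (hTAB : T = A + Complex.I • B) :
    IsWellBounded (A + B) := by
  obtain ⟨ψ, ⟨K, hψ⟩, hid, hψT⟩ := hT
  have h10 : (1 : ℝ) ≠ 0 ∨ (0 : ℝ) ≠ 0 := Or.inl one_ne_zero
  have h01 : (0 : ℝ) ≠ 0 ∨ (1 : ℝ) ≠ 0 := Or.inr one_ne_zero
  let re : AC σ := ⟨_, planeFunctional_mem_AC hσ h10⟩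
  let im : AC σ := ⟨_, planeFunctional_mem_AC hσ h01⟩
  set A' := ψ re with hA'def
  set B' := ψ im with hB'def
  have hA' : IsWellBounded A' := isWellBounded_map_planeFunctional hσ hψ h10 rfl
  have hB' : IsWellBounded B' := isWellBounded_map_planeFunctional hσ hψ h01 rfl
  have hAB' : Commute A' B' := (Commute.all re im).map ψ
  have hT' : T = A' + Complex.I • B' := by
    rw [← hψT, hA'def, hB'def, ← map_smul, ← map_add]
    congr 1
    apply Subtype.ext
    ext z
    change (z : ℂ) = (planeFunctional 1 0 z : ℂ) + Complex.I * (planeFunctional 0 1 z : ℂ)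
    apply Complex.ext <;> simp [planeFunctional]
  have hAc : IsCompactOperator A' :=
    hA'.isCompactOperator_of_add_I_smul hB' hAB' (hT' ▸ hTc)
  have hBc : IsCompactOperator B' := by
    have e : B' = -(Complex.I • (T - A')) := by
      rw [hT', add_sub_cancel_left, smul_smul, Complex.I_mul_I, neg_one_smul, neg_neg]
    rw [e]
    exact ((hTc.sub hAc).smul Complex.I).neg
  set D := A - A' with hD
  have hDfix : ∀ s : AC σ, IsCompactOperator (ψ s) → ∀ x, ψ s x = x → D x = 0 := by
    intro s hs x hx
    have hcomm : Commute (ψ s) (A + Complex.I • B) := by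
      rw [← hTAB, ← hψT]
      exact (Commute.all s _).map ψ
    exact sub_eq_zero.2
      (hA.eqOn_ker_sub_one hB hAB hA' hB' hAB' (hTAB.symm.trans hT') hs hcomm hx)
  have hDA' : D * A' = 0 := mul_map_planeFunctional_eq_zero hσ hψ h10 rfl hAc hDfix
  have hDB' : D * B' = 0 := mul_map_planeFunctional_eq_zero hσ hψ h01 rfl hBc hDfix
  have hTA : Commute T A := by
    rw [hTAB]
    exact (Commute.refl A).add_left (hAB.symm.smul_left _)
  have hTA' : Commute T A' := by
    rw [hT']
    exact (Commute.refl A').add_left (hAB'.symm.smul_left _)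
  have hTD : T * D = 0 := by
    rw [(hTA.sub_right hTA').eq, hT', mul_add, hDA', mul_smul_comm, hDB', smul_zero, add_zero]
  -- the range of `D` consists of null vectors of `T`, which `A` and `A'` annihilate as well
  have hker : ∀ x, T (D x) = 0 := fun x => DFunLike.congr_fun hTD x
  have hAD : A * D = 0 := by
    ext x
    have := hA.apply_eq_of_pow_apply_eq_zero hB hAB (μ := 0) (k := 1) (x := D x)
      (by simpa [← hTAB] using hker x)
    simpa using this
  have hA'D : A' * D = 0 := by
    ext x
    have := hA'.apply_eq_of_pow_apply_eq_zero hB' hAB' (μ := 0) (k := 1) (x := D x)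
      (by simpa [← hT'] using hker x)
    simpa using this
  have hAA' : A = A' := hA.eq_of_mul_sub_eq_zero hA' hAD hA'D hDA'
  have hBB' : B = B' := by
    have h := hTAB.symm.trans hT'
    rw [hAA'] at h
    exact smul_right_injective _ Complex.I_ne_zero (add_left_cancel h)
  rw [hAA', hBB', hA'def, hB'def, ← map_add]
  refine isWellBounded_map_planeFunctional hσ hψ (α := 1) (β := 1) (Or.inl one_ne_zero) ?_
  ext z
  change (planeFunctional 1 0 z : ℂ) + (planeFunctional 0 1 z : ℂ) = _
  rw [← Complex.ofReal_add]
  congr 1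
  simp [planeFunctional]
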